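/- For an even, continuous, $2\pi$-periodic function $f:\mathbb R\to\mathbb R$ with cosine coefficients $a_0=\frac1{2\pi}\int_{-\pi}^{\pi}f\,dx$ and $a_k=\frac1\pi\int_{-\pi}^{\pi}f(x)\cos(kx)\,dx$ ($k\ge1$), let $$Lf(x)=\sum_{k\ge0}a_k\,m(k)\cos(kx),\qquad m(0)=1,\quad m(k)=\Big(\frac{\tanh k}{k}\Big)^{1/2}\ (k\ge 1),$$ whenever this series converges absolutely for every $x$. A continuous, even, $2\pi$-periodic function $\varphi$ is called a Whitham solution with wave speed $\mu\in\mathbb R$ if $L\varphi$ is defined in this sense and $\mu\varphi-L\varphi-\varphi^2=0$ on $\mathbb R$. Fix $\alpha_0\in(\frac12,1)$ and let $S$ be the set of pairs $(\varphi,\mu)$ such that $0<\mu<1$, $\varphi$ is even, $2\pi$-periodic and $\alpha_0$-Hölder continuous, $\varphi(x)<\mu/2$ for all $x$, and $\varphi$ is a Whitham solution with wave speed $\mu$. **Theorem 4.7 (Uniform convergence).** Let $(\varphi_n,\mu_n)_{n}$ be any sequence in $S$. Then there is a subsequence along which $\varphi_n$ converges uniformly on $\mathbb R$ to a function $\varphi$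 and $\mu_n$ converges to some $\mu\in[0,1]$, such that $\varphi\le\mu/2$, $\varphi$ is a Whitham solution with wave speed $\mu$ (in particular continuous, even and $2\pi$-periodic), and $\varphi$ is $\alpha$-Hölder continuous on $\mathbb R$ for every $\alpha\in(0,\frac12)$. Moreover, for every $x$ with $\varphi(x)<\mu/2$ and every $\alpha\in(0,1)$, $\varphi$ is $\alpha$-Hölder continuous on a neighbourhood of $x$. -/

import Mathlib

open Filter Topology
open scoped NNReal

noncomputable section

namespace Whitham

/-- The symbol `(tanh k / k) ^ (1/2)` of the Whitham kernel at the integer frequencies `k ≥ 0`,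
with its continuous value `1` at `k = 0`. -/
def symbol (k : ℕ) : ℝ :=
  if k = 0 then 1 else Real.sqrt (Real.tanh (k : ℝ) / (k : ℝ))

/-- The coefficients `a_k` of the cosine series `∑_{k ≥ 0} a_k cos (k x)` of an even
`2π`-periodic function. -/
def cosCoeff (f : ℝ → ℝ) (k : ℕ) : ℝ :=
  if k = 0 then (2 * Real.pi)⁻¹ * ∫ x in (-Real.pi)..Real.pi, f x
  else Real.pi⁻¹ * ∫ x in (-Real.pi)..Real.pi, f x * Real.cos (k * x)

/-- `IsWhithamImage f g` says that `g = L f`, where `L` is the Whitham operator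
`L f (x) = ∑_{k ≥ 0} a_k (tanh k / k) ^ (1/2) cos (k x)`. The series is required to
converge (unconditionally, hence absolutely) at every point. -/
def IsWhithamImage (f g : ℝ → ℝ) : Prop :=
  ∀ x : ℝ, HasSum (fun k : ℕ => cosCoeff f k * symbol k * Real.cos (k * x)) (g x)

/-- `φ` is a continuous, even, `2π`-periodic solution of the steady Whitham equation
`μ φ - L φ - φ ^ 2 = 0`. -/
structure IsSolution (φ : ℝ → ℝ) (μ : ℝ) : Prop where
  continuous : Continuous φ
  periodic : Function.Periodic φ (2 * Real.pi)
  even : Function.Even φ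
  equation : IsWhithamImage φ (fun x => μ * φ x - φ x ^ 2)

/-- The space of even, `2π`-periodic, real functions that are Hölder continuous
with exponent `α`. -/
def HolderEven (α : ℝ≥0) : Set (ℝ → ℝ) :=
  {φ | Function.Periodic φ (2 * Real.pi) ∧ Function.Even φ ∧ ∃ C : ℝ≥0, HolderWith C α φ}

/-- The set `S` of solutions `(φ, μ)` with `φ` in the even Hölder space of exponent `α`,
`0 < μ < 1` and `φ < μ / 2` everywhere. -/
def solutionSet (α : ℝ≥0) : Set ((ℝ → ℝ) × ℝ) :=
  {p | p.1 ∈ HolderEven α ∧ p.2 ∈ Set.Ioo (0 : ℝ) 1 ∧ (∀ x, p.1 x < p.2 / 2) ∧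
    IsSolution p.1 p.2}

end Whitham

end

/-!
Write `u = μ / 2 - φ`. Completing the square turns the Whitham equation into
`u ^ 2 = μ ^ 2 / 4 - L φ`, so along solutions with `φ ≤ μ / 2` the regularity of `φ` is that of the
square root of a function which is half a derivative smoother than `φ`.

*Smoothing.* The symbol is `k^{-1/2}` up to a rapidly decaying remainder, and `k^{-1/2}` is, up to a
positive constant, `∫₀^∞ t^{-1/2} sinc (k t) ^ 2 dt`, where `sinc (k t) ^ 2` is the multiplier of the
twofold average over intervals of radius `t`. An increment over distance `h` of such an average of a
`β`-Hölder function is at most `M h ^ β`, and also at most `M h (2 t) ^ (β - 1)`. Integrating the first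
bound over `t ≤ h` and the second over `t > h` gives `h ^ (β + 1/2)` for `0 ≤ β < 1/2`: this is
`exists_holderBound_image`, which needs no information on the convolution kernel of `L`.

*Compactness.* With `β = 0`, smoothing bounds `L φ` linearly in `sup |φ|`, and the quadratic term of
the equation then bounds `sup |φ|` uniformly (`exists_abs_solution_le`). Taking the square root, all
solutions are uniformly `1/4`-Hölder (`exists_holderBound_solution`), and Arzelà–Ascoli provides the
subsequence. The limit has the limiting cosine coefficients; as it is Hölder continuous, Bernstein's
criterion (`summable_abs_cosCoeff_mul_rpow_of_holderBound`) makes its Whitham series absolutely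
convergent, so it solves the equation (`isSolution_of_tendsto`).

*Regularity.* On the limit, the gain `β ↦ β / 2 + 1 / 4` iterates to every exponent below `1/2`. Hence
`L φ` is `α`-Hölder for every `α < 1`, and so is `φ` where `u > 0`, the square root being smooth there.
-/

namespace Whitham

open MeasureTheory

/-! ### Cosine coefficients of even periodic functions -/

theorem cosCoeff_eq (f : ℝ → ℝ) (k : ℕ) :
    cosCoeff f k = (if k = 0 then (2 * Real.pi)⁻¹ else Real.pi⁻¹) *
      ∫ x in (-Real.pi)..Real.pi, f x * Real.cos (k * x) := by
  unfold cosCoeff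
  split_ifs with h
  · simp [h]
  · rfl

theorem integral_comp_add_period {G : ℝ → ℝ} (hG : Function.Periodic G (2 * Real.pi)) (s : ℝ) :
    ∫ x in (-Real.pi)..Real.pi, G (x + s) = ∫ x in (-Real.pi)..Real.pi, G x := by
  rw [intervalIntegral.integral_comp_add_right]
  have := hG.intervalIntegral_add_eq (-Real.pi + s) (-Real.pi)
  rw [show -Real.pi + s + 2 * Real.pi = Real.pi + s by ring,
    show -Real.pi + 2 * Real.pi = Real.pi by ring] at this
  exact this

theorem integral_eq_zero_of_odd {G : ℝ → ℝ} (hG : ∀ x, G (-x) = -G x) (a : ℝ) :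
    ∫ x in (-a)..a, G x = 0 := by
  have h := intervalIntegral.integral_comp_neg (a := -a) (b := a) G
  simp only [hG, intervalIntegral.integral_neg, neg_neg] at h
  linarith

theorem integral_mul_sin_eq_zero {f : ℝ → ℝ} (he : Function.Even f) (k : ℝ) :
    ∫ x in (-Real.pi)..Real.pi, f x * Real.sin (k * x) = 0 :=
  integral_eq_zero_of_odd (fun x => by rw [he x, mul_neg, Real.sin_neg]; ring) _

theorem cos_nat_periodic (k : ℕ) (s : ℝ) :
    Function.Periodic (fun x : ℝ => Real.cos (k * (x - s))) (2 * Real.pi) := fun x => by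
  simp only
  rw [show (k : ℝ) * (x + 2 * Real.pi - s) = k * (x - s) + k * (2 * Real.pi) by ring,
    Real.cos_add_nat_mul_two_pi]

theorem sin_nat_periodic (k : ℕ) (s : ℝ) :
    Function.Periodic (fun x : ℝ => Real.sin (k * (x - s))) (2 * Real.pi) := fun x => by
  simp only
  rw [show (k : ℝ) * (x + 2 * Real.pi - s) = k * (x - s) + k * (2 * Real.pi) by ring,
    Real.sin_add_nat_mul_two_pi]

theorem integral_shift_mul_cos {f : ℝ → ℝ} (hc : Continuous f)
    (hp : Function.Periodic f (2 * Real.pi)) (he : Function.Even f) (k : ℕ) (s : ℝ) :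
    ∫ x in (-Real.pi)..Real.pi, f (x + s) * Real.cos (k * x) =
      Real.cos (k * s) * ∫ x in (-Real.pi)..Real.pi, f x * Real.cos (k * x) := by
  have h := integral_comp_add_period (hp.mul (cos_nat_periodic k s)) s
  simp only [Pi.mul_apply, add_sub_cancel_right] at h
  rw [h]
  have e : ∀ x, f x * Real.cos (k * (x - s)) = Real.cos (k * s) * (f x * Real.cos (k * x)) +
      Real.sin (k * s) * (f x * Real.sin (k * x)) := fun x => by
    rw [mul_sub, Real.cos_sub]; ring
  simp only [e]
  rw [intervalIntegral.integral_add (by apply Continuous.intervalIntegrable; fun_prop)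
    (by apply Continuous.intervalIntegrable; fun_prop), intervalIntegral.integral_const_mul,
    intervalIntegral.integral_const_mul, integral_mul_sin_eq_zero he]
  ring

theorem integral_shift_mul_sin {f : ℝ → ℝ} (hc : Continuous f)
    (hp : Function.Periodic f (2 * Real.pi)) (he : Function.Even f) (k : ℕ) (s : ℝ) :
    ∫ x in (-Real.pi)..Real.pi, f (x + s) * Real.sin (k * x) =
      -Real.sin (k * s) * ∫ x in (-Real.pi)..Real.pi, f x * Real.cos (k * x) := by
  have h := integral_comp_add_period (hp.mul (sin_nat_periodic k s)) s
  simp only [Pi.mul_apply, add_sub_cancel_right] at h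
  rw [h]
  have e : ∀ x, f x * Real.sin (k * (x - s)) = Real.cos (k * s) * (f x * Real.sin (k * x)) +
      -Real.sin (k * s) * (f x * Real.cos (k * x)) := fun x => by
    rw [mul_sub, Real.sin_sub]; ring
  simp only [e]
  rw [intervalIntegral.integral_add (by apply Continuous.intervalIntegrable; fun_prop)
    (by apply Continuous.intervalIntegrable; fun_prop), intervalIntegral.integral_const_mul,
    intervalIntegral.integral_const_mul, integral_mul_sin_eq_zero he]
  ring

theorem integral_cos_nat (k : ℕ) : ∫ x in (-Real.pi)..Real.pi, Real.cos (k * x) =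
    if k = 0 then 2 * Real.pi else 0 := by
  split_ifs with h
  · simp [h]; ring
  · have : (k : ℝ) ≠ 0 := by exact_mod_cast h
    rw [intervalIntegral.integral_comp_mul_left _ this, integral_cos]
    simp

theorem integral_cos_mul_cos (j k : ℕ) :
    ∫ x in (-Real.pi)..Real.pi, Real.cos (j * x) * Real.cos (k * x) =
      if j = k then (if k = 0 then 2 * Real.pi else Real.pi) else 0 := by
  wlog hjk : k ≤ j generalizing j k
  · have := this k j (by omega)
    simp only [mul_comm (Real.cos (j * _))]
    rw [this]
    by_cases h : j = k
    · simp [h]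
    · simp [h, Ne.symm h]
  have e : ∀ x : ℝ, Real.cos (j * x) * Real.cos (k * x) =
      (1 / 2) * Real.cos ((j + k : ℕ) * x) + (1 / 2) * Real.cos ((j - k : ℕ) * x) := fun x => by
    rw [Nat.cast_sub hjk]; push_cast
    rw [add_mul, sub_mul, Real.cos_add, Real.cos_sub]; ring
  simp only [e]
  rw [intervalIntegral.integral_add (by apply Continuous.intervalIntegrable; fun_prop)
    (by apply Continuous.intervalIntegrable; fun_prop), intervalIntegral.integral_const_mul,
    intervalIntegral.integral_const_mul, integral_cos_nat, integral_cos_nat]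
  by_cases h : j = k
  · subst h
    by_cases h0 : j = 0
    · simp [h0]; ring
    · simp [h0]
  · have h1 : ¬ (j + k = 0) := by omega
    have h2 : ¬ (j - k = 0) := by omega
    simp only [h, h1, h2, if_false]; ring

/-- Termwise integration against `cos (j x)`, justified by absolute convergence. -/
theorem cosCoeff_eq_of_hasSum {b : ℕ → ℝ} {g : ℝ → ℝ} (hb : Summable b)
    (hg : ∀ x, HasSum (fun k : ℕ => b k * Real.cos (k * x)) (g x)) (j : ℕ) :
    cosCoeff g j = b j := by
  have key : HasSum (fun k : ℕ => ∫ x in (-Real.pi)..Real.pi,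
      b k * Real.cos (k * x) * Real.cos (j * x))
      (∫ x in (-Real.pi)..Real.pi, g x * Real.cos (j * x)) := by
    refine intervalIntegral.hasSum_integral_of_dominated_convergence (fun k _ => |b k|)
      (fun k => (by fun_prop : Continuous fun x : ℝ =>
        b k * Real.cos (k * x) * Real.cos (j * x)).aestronglyMeasurable)
      (fun k => ae_of_all _ fun x _ => ?_) (ae_of_all _ fun x _ => hb.abs) ?_
      (ae_of_all _ fun x _ => (hg x).mul_right _)
    · rw [norm_mul, norm_mul, Real.norm_eq_abs, Real.norm_eq_abs, Real.norm_eq_abs, mul_assoc]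
      exact mul_le_of_le_one_right (abs_nonneg _)
        (mul_le_one₀ (Real.abs_cos_le_one _) (abs_nonneg _) (Real.abs_cos_le_one _))
    · exact intervalIntegrable_const
  have e : ∀ k : ℕ, ∫ x in (-Real.pi)..Real.pi, b k * Real.cos (k * x) * Real.cos (j * x) =
      if k = j then b j * (if j = 0 then 2 * Real.pi else Real.pi) else 0 := fun k => by
    simp only [mul_assoc]
    rw [intervalIntegral.integral_const_mul, integral_cos_mul_cos]
    by_cases h : k = j <;> simp [h]
  simp only [e] at key
  rw [cosCoeff_eq, ← key.tsum_eq, tsum_ite_eq]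
  have := Real.pi_pos
  split_ifs <;> field_simp

/-- The constant mode does not contribute to the higher cosine coefficients, so that these are
controlled by the oscillation of the function. -/
theorem abs_cosCoeff_le {f : ℝ → ℝ} (hc : Continuous f) {B : ℝ}
    (hB : ∀ x ∈ Set.Icc (-Real.pi) Real.pi, |f x - f 0| ≤ B) {k : ℕ} (hk : k ≠ 0) :
    |cosCoeff f k| ≤ 2 * B := by
  have hpi := Real.pi_pos
  have e : ∫ x in (-Real.pi)..Real.pi, f x * Real.cos (k * x) =
      ∫ x in (-Real.pi)..Real.pi, (f x - f 0) * Real.cos (k * x) := by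
    simp only [sub_mul]
    rw [intervalIntegral.integral_sub (by apply Continuous.intervalIntegrable; fun_prop)
      (by apply Continuous.intervalIntegrable; fun_prop), intervalIntegral.integral_const_mul,
      integral_cos_nat]
    simp [hk]
  rw [cosCoeff_eq, if_neg hk, e, abs_mul, abs_of_pos (inv_pos.2 hpi)]
  have := intervalIntegral.norm_integral_le_of_norm_le_const (a := -Real.pi) (b := Real.pi)
    (C := B) (f := fun x => (f x - f 0) * Real.cos (k * x)) (fun x hx => by
      rw [Set.uIoc_of_le (by linarith)] at hx
      rw [norm_mul, Real.norm_eq_abs, Real.norm_eq_abs]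
      exact (mul_le_of_le_one_right (abs_nonneg _) (Real.abs_cos_le_one _)).trans
        (hB x ⟨hx.1.le, hx.2⟩))
  rw [Real.norm_eq_abs, show Real.pi - -Real.pi = 2 * Real.pi by ring,
    abs_of_pos (by positivity : 0 < 2 * Real.pi)] at this
  calc Real.pi⁻¹ * _ ≤ Real.pi⁻¹ * (B * (2 * Real.pi)) := by gcongr
    _ = 2 * B := by field_simp

theorem fact_two_pi_pos : Fact (0 < 2 * Real.pi) := ⟨Real.two_pi_pos⟩

attribute [local instance] fact_two_pi_pos

theorem fourier_two_pi (n : ℤ) (x : ℝ) :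
    fourier n (x : AddCircle (2 * Real.pi)) =
      (Real.cos (n * x) : ℂ) + Real.sin (n * x) * Complex.I := by
  have : (Real.pi : ℂ) ≠ 0 := by exact_mod_cast Real.pi_ne_zero
  rw [fourier_coe_apply, Complex.ofReal_cos, Complex.ofReal_sin, ← Complex.exp_mul_I]
  congr 1
  push_cast
  field_simp

theorem intervalIntegral_fourier_mul {f : ℝ → ℝ} (hc : Continuous f) (n : ℤ) :
    ∫ x in (-Real.pi)..Real.pi, fourier (-n) (x : AddCircle (2 * Real.pi)) • (f x : ℂ) =
      ((∫ x in (-Real.pi)..Real.pi, f x * Real.cos (n * x) : ℝ) : ℂ) -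
      ((∫ x in (-Real.pi)..Real.pi, f x * Real.sin (n * x) : ℝ) : ℂ) * Complex.I := by
  rw [← intervalIntegral.integral_ofReal, ← intervalIntegral.integral_ofReal,
    ← intervalIntegral.integral_mul_const, ← intervalIntegral.integral_sub
    (by apply Continuous.intervalIntegrable; fun_prop)
    (by apply Continuous.intervalIntegrable; fun_prop)]
  refine intervalIntegral.integral_congr fun x _ => ?_
  simp only [fourier_two_pi, smul_eq_mul]
  push_cast
  rw [neg_mul, Complex.cos_neg, Complex.sin_neg]
  ring

theorem fourierCoeff_eq_cosCoeff {f : ℝ → ℝ} (hc : Continuous f) (he : Function.Even f)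
    (F : AddCircle (2 * Real.pi) → ℂ) (hF : ∀ x : ℝ, F x = f x) (n : ℤ) :
    fourierCoeff F n = ((if n = 0 then cosCoeff f 0 else cosCoeff f n.natAbs / 2 : ℝ) : ℂ) := by
  rw [fourierCoeff_eq_intervalIntegral F n (-Real.pi)]
  simp only [hF]
  rw [show -Real.pi + 2 * Real.pi = Real.pi by ring, intervalIntegral_fourier_mul hc,
    integral_mul_sin_eq_zero he]
  have hcos : ∀ x : ℝ, Real.cos ((n : ℝ) * x) = Real.cos ((n.natAbs : ℝ) * x) := fun x => by
    rcases Int.natAbs_eq n with h | h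
    · conv_lhs => rw [h]
      simp
    · conv_lhs => rw [h]
      simp
  simp only [hcos, cosCoeff_eq, Complex.real_smul]
  rw [Complex.ofReal_zero, zero_mul, sub_zero, ← Complex.ofReal_mul]
  congr 1
  by_cases h : n = 0
  · simp [h]
  · simp [h]; ring

/-- The real form, for even functions, of the pointwise convergence of summable Fourier series on the
circle: the frequencies `±k` combine into the cosine mode `k`. -/
theorem hasSum_cosCoeff {f : ℝ → ℝ} (hc : Continuous f)
    (hp : Function.Periodic f (2 * Real.pi)) (he : Function.Even f)
    (hs : Summable (cosCoeff f)) (x : ℝ) :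
    HasSum (fun k : ℕ => cosCoeff f k * Real.cos (k * x)) (f x) := by
  have hp' : Function.Periodic (fun x => (f x : ℂ)) (2 * Real.pi) := fun x => by simp [hp x]
  let F : C(AddCircle (2 * Real.pi), ℂ) := ⟨hp'.lift, continuous_coinduced_dom.mpr (by
    change Continuous fun x => (f x : ℂ)
    fun_prop)⟩
  have hF : ∀ x : ℝ, F x = f x := fun x => hp'.lift_coe x
  have hco := fourierCoeff_eq_cosCoeff hc he F hF
  have hsum : Summable (fourierCoeff F) := by
    have h2 : Summable fun k : ℕ => |cosCoeff f k| := hs.abs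
    have hb : ∀ n : ℤ, ‖fourierCoeff F n‖ ≤ |cosCoeff f n.natAbs| := fun n => by
      rw [hco n, Complex.norm_real, Real.norm_eq_abs]
      split_ifs with h
      · simp [h]
      · rw [abs_div, abs_two]; linarith [abs_nonneg (cosCoeff f n.natAbs)]
    refine Summable.of_norm_bounded (g := fun n : ℤ => |cosCoeff f n.natAbs|) ?_ hb
    refine Summable.of_nat_of_neg ?_ ?_ <;> simpa using h2
  have h := (has_pointwise_sum_fourier_series_of_summable hsum (x : AddCircle (2 * Real.pi)))
  have h3 := h.nat_add_neg
  rw [hF, hco] at h3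
  have h4 := Complex.hasSum_re h3
  have h5 := h4.sub (hasSum_ite_eq (0 : ℕ) (cosCoeff f 0))
  have e : ∀ k : ℕ, cosCoeff f k * Real.cos (k * x) =
      (fourierCoeff F (k : ℤ) • fourier (k : ℤ) (x : AddCircle (2 * Real.pi)) +
        fourierCoeff F (-(k : ℤ)) • fourier (-(k : ℤ)) (x : AddCircle (2 * Real.pi))).re -
        if k = 0 then cosCoeff f 0 else 0 := fun k => by
    simp only [hco, fourier_two_pi, smul_eq_mul, Complex.add_re, Complex.re_ofReal_mul,
      Complex.ofReal_re, Complex.re_ofReal_mul, Complex.I_re]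
    by_cases hk : k = 0
    · simp [hk]
    · simp only [Int.cast_neg, Int.cast_natCast, neg_mul, Real.cos_neg, Int.natAbs_neg,
        Int.natAbs_natCast, neg_eq_zero, Nat.cast_eq_zero, hk, if_false]
      ring
  have e2 : f x = ((f x : ℂ) + ((if (0 : ℤ) = 0 then cosCoeff f 0 else
      cosCoeff f (Int.natAbs 0) / 2 : ℝ) : ℂ) •
        fourier 0 (x : AddCircle (2 * Real.pi))).re - cosCoeff f 0 := by
    rw [fourier_two_pi]
    simp
  rw [funext e, e2]
  exact h5

/-! ### Symmetric averages -/

/-- `f` is Hölder continuous on `ℝ` with exponent `β` and constant `M`, in real arithmetic. For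
`β = 0` this says that the oscillation of `f` is at most `M`, as `0 ^ 0 = 1`. -/
def HolderBound (β M : ℝ) (f : ℝ → ℝ) : Prop :=
  ∀ x y, |f x - f y| ≤ M * |x - y| ^ β

/-- The mean of `f` over the interval of radius `t` centred at `x`. -/
noncomputable def avg (t : ℝ) (f : ℝ → ℝ) (x : ℝ) : ℝ :=
  (2 * t)⁻¹ * ∫ s in (-t)..t, f (x + s)

theorem HolderBound.nonneg {β M : ℝ} {f : ℝ → ℝ} (h : HolderBound β M f) : 0 ≤ M := by
  have := (abs_nonneg _).trans (h 1 0)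
  simpa using this

theorem continuous_avg (t : ℝ) {f : ℝ → ℝ} (hc : Continuous f) : Continuous (avg t f) := by
  unfold avg
  refine continuous_const.mul
    (intervalIntegral.continuous_parametric_intervalIntegral_of_continuous' (by
      simp only [Function.uncurry_def]; fun_prop) _ _)

theorem periodic_avg (t : ℝ) {f : ℝ → ℝ} {T : ℝ} (hp : Function.Periodic f T) :
    Function.Periodic (avg t f) T := fun x => by
  unfold avg
  congr 1
  refine intervalIntegral.integral_congr fun s _ => ?_
  rw [show x + T + s = x + s + T by ring, hp]

theorem even_avg (t : ℝ) {f : ℝ → ℝ} (he : Function.Even f) : Function.Even (avg t f) := fun x => by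
  unfold avg
  congr 1
  have h := intervalIntegral.integral_comp_neg (a := -t) (b := t) fun s => f (x + s)
  rw [neg_neg] at h
  rw [← h]
  refine intervalIntegral.integral_congr fun s _ => ?_
  rw [← he (x + -s)]
  congr 1
  ring

theorem HolderBound.avg {β M t : ℝ} {f : ℝ → ℝ} (h : HolderBound β M f) (ht : 0 < t)
    (hc : Continuous f) : HolderBound β M (avg t f) := fun x y => by
  unfold Whitham.avg
  rw [← mul_sub, ← intervalIntegral.integral_sub (by apply Continuous.intervalIntegrable; fun_prop)
    (by apply Continuous.intervalIntegrable; fun_prop), abs_mul,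
    abs_of_pos (by positivity : 0 < (2 * t)⁻¹)]
  have := intervalIntegral.norm_integral_le_of_norm_le_const (a := -t) (b := t)
    (C := M * |x - y| ^ β) (f := fun s => f (x + s) - f (y + s)) (fun s _ => by
      have := h (x + s) (y + s)
      rwa [add_sub_add_right_eq_sub] at this)
  rw [Real.norm_eq_abs, show t - -t = 2 * t by ring, abs_of_pos (by positivity : 0 < 2 * t)] at this
  calc (2 * t)⁻¹ * _ ≤ (2 * t)⁻¹ * (M * |x - y| ^ β * (2 * t)) := by gcongr
    _ = _ := by field_simp

/-- Translating an average by `h` only changes the two end pieces of the interval, which lie at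
distance `2 t` from each other. -/
theorem HolderBound.abs_avg_add_sub_le {β M t h : ℝ} {f : ℝ → ℝ} (hf : HolderBound β M f)
    (ht : 0 < t) (hc : Continuous f) (hh : 0 ≤ h) (x : ℝ) :
    |Whitham.avg t f (x + h) - Whitham.avg t f x| ≤ M * h * (2 * t) ^ (β - 1) := by
  have hi : ∀ a b, IntervalIntegrable f volume a b := fun a b => hc.intervalIntegrable a b
  have e : Whitham.avg t f (x + h) - Whitham.avg t f x =
      (2 * t)⁻¹ * ∫ s in (0 : ℝ)..h, (f (x + t + s) - f (x - t + s)) := by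
    unfold Whitham.avg
    rw [← mul_sub, intervalIntegral.integral_sub (by apply Continuous.intervalIntegrable; fun_prop)
      (by apply Continuous.intervalIntegrable; fun_prop)]
    simp only [intervalIntegral.integral_comp_add_left]
    rw [intervalIntegral.integral_interval_sub_interval_comm (hi _ _) (hi _ _) (hi _ _),
      intervalIntegral.integral_symm (x + -t)]
    rw [intervalIntegral.integral_symm (x + t)]
    simp only [add_zero]
    rw [show x + h + t = x + t + h by ring, show x + h + -t = x - t + h by ring,
      show x + -t = x - t by ring]
    ring
  rw [e, abs_mul, abs_of_pos (by positivity : 0 < (2 * t)⁻¹)]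
  have := intervalIntegral.norm_integral_le_of_norm_le_const (a := 0) (b := h)
    (C := M * (2 * t) ^ β) (f := fun s => f (x + t + s) - f (x - t + s)) (fun s _ => by
      have := hf (x + t + s) (x - t + s)
      rwa [show x + t + s - (x - t + s) = 2 * t by ring,
        abs_of_pos (by positivity : 0 < 2 * t)] at this)
  rw [Real.norm_eq_abs, sub_zero, abs_of_nonneg hh] at this
  calc (2 * t)⁻¹ * _ ≤ (2 * t)⁻¹ * (M * (2 * t) ^ β * h) := by gcongr
    _ = _ := by rw [Real.rpow_sub_one (by positivity)]; field_simp

theorem integral_cos_mul_eq_sinc (k t : ℝ) (ht : t ≠ 0) :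
    ∫ s in (-t)..t, Real.cos (k * s) = 2 * t * Real.sinc (k * t) := by
  by_cases hk : k = 0
  · simp [hk]; ring
  · rw [intervalIntegral.integral_comp_mul_left _ hk, integral_cos, Real.sinc_of_ne_zero
      (mul_ne_zero hk ht), mul_neg, Real.sin_neg, smul_eq_mul]
    field_simp
    ring

/-- Averaging over radius `t` is the Fourier multiplier `sinc (k t)`. -/
theorem cosCoeff_avg {t : ℝ} (ht : 0 < t) {f : ℝ → ℝ} (hc : Continuous f)
    (hp : Function.Periodic f (2 * Real.pi)) (he : Function.Even f) (k : ℕ) :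
    cosCoeff (avg t f) k = cosCoeff f k * Real.sinc (k * t) := by
  rw [cosCoeff_eq, cosCoeff_eq, mul_assoc]
  congr 1
  have e : ∀ x, avg t f x * Real.cos (k * x) =
      (2 * t)⁻¹ * ∫ s in (-t)..t, f (x + s) * Real.cos (k * x) := fun x => by
    rw [intervalIntegral.integral_mul_const, avg, mul_assoc]
  simp only [e]
  rw [intervalIntegral.integral_const_mul, intervalIntegral_intervalIntegral_swap]
  · simp only [integral_shift_mul_cos hc hp he]
    rw [intervalIntegral.integral_mul_const, integral_cos_mul_eq_sinc _ _ ht.ne']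
    field_simp
  · have hcont : Continuous (Function.uncurry fun x s => f (x + s) * Real.cos (k * x)) := by
      simp only [Function.uncurry_def]; fun_prop
    exact (hcont.continuousOn.integrableOn_compact (isCompact_uIcc.prod isCompact_uIcc)).mono_set
      (Set.prod_mono Set.uIoc_subset_uIcc Set.uIoc_subset_uIcc)

/-! ### Fractional integration as a superposition of averages -/

theorem sinc_sq_le_inv_sq {x : ℝ} (hx : x ≠ 0) : Real.sinc x ^ 2 ≤ (x ^ 2)⁻¹ := by
  rw [Real.sinc_of_ne_zero hx, div_pow, ← one_div]
  gcongr
  exact Real.sin_sq_le_one x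

theorem sinc_sq_le_one (x : ℝ) : Real.sinc x ^ 2 ≤ 1 := by
  rw [sq_le_one_iff_abs_le_one]; exact Real.abs_sinc_le_one x

theorem continuousOn_rpow_Ioi (r : ℝ) : ContinuousOn (fun t : ℝ => t ^ r) (Set.Ioi 0) :=
  fun t ht => (Real.continuousAt_rpow_const t r (Or.inl (ne_of_gt ht))).continuousWithinAt

theorem integrableOn_rpow_Ioc {r : ℝ} (hr : -1 < r) (h : ℝ) :
    IntegrableOn (fun t : ℝ => t ^ r) (Set.Ioc 0 h) := by
  rcases le_or_gt 0 h with hh | hh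
  · exact (intervalIntegrable_iff_integrableOn_Ioc_of_le hh).1
      (intervalIntegral.intervalIntegrable_rpow' hr)
  · simp [Set.Ioc_eq_empty (not_lt.2 hh.le)]

theorem integrableOn_rpow_mul_sinc_sq {k : ℝ} (hk : 0 < k) :
    IntegrableOn (fun t : ℝ => t ^ (-(1 / 2) : ℝ) * Real.sinc (k * t) ^ 2) (Set.Ioi 0) := by
  have hm : ContinuousOn (fun t : ℝ => t ^ (-(1 / 2) : ℝ) * Real.sinc (k * t) ^ 2) (Set.Ioi 0) :=
    (continuousOn_rpow_Ioi _).mul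
      ((Real.continuous_sinc.comp (continuous_const.mul continuous_id)).pow 2).continuousOn
  rw [← Set.Ioc_union_Ioi_eq_Ioi zero_le_one]
  refine IntegrableOn.union ?_ ?_
  · refine Integrable.mono' (integrableOn_rpow_Ioc (r := -(1 / 2)) (by norm_num) 1)
      ((hm.mono Set.Ioc_subset_Ioi_self).aestronglyMeasurable measurableSet_Ioc) ?_
    filter_upwards [ae_restrict_mem measurableSet_Ioc] with t ht
    have : 0 ≤ t ^ (-(1 / 2) : ℝ) := Real.rpow_nonneg ht.1.le _
    rw [Real.norm_eq_abs, abs_of_nonneg (by positivity)]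
    exact mul_le_of_le_one_right this (sinc_sq_le_one _)
  · refine Integrable.mono' ((integrableOn_Ioi_rpow_of_lt (a := -(5 / 2)) (by norm_num)
      zero_lt_one).const_mul (k ^ 2)⁻¹)
      ((hm.mono (Set.Ioi_subset_Ioi zero_le_one)).aestronglyMeasurable measurableSet_Ioi) ?_
    filter_upwards [ae_restrict_mem measurableSet_Ioi] with t ht
    have ht0 : 0 < t := zero_lt_one.trans ht
    have : 0 ≤ t ^ (-(1 / 2) : ℝ) := Real.rpow_nonneg ht0.le _
    rw [Real.norm_eq_abs, abs_of_nonneg (by positivity)]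
    calc t ^ (-(1 / 2) : ℝ) * Real.sinc (k * t) ^ 2
        ≤ t ^ (-(1 / 2) : ℝ) * ((k * t) ^ 2)⁻¹ := by
          gcongr
          exact sinc_sq_le_inv_sq (by positivity)
      _ = (k ^ 2)⁻¹ * t ^ (-(5 / 2) : ℝ) := by
          rw [show (-(5 / 2) : ℝ) = -(1 / 2) - (2 : ℕ) by norm_num, Real.rpow_sub_natCast ht0.ne',
            mul_pow]
          field_simp

/-- The normalizing constant `∫₀^∞ t^{-1/2} (sin t / t)² dt`. -/
noncomputable def sincConst : ℝ :=
  ∫ t in Set.Ioi (0 : ℝ), t ^ (-(1 / 2) : ℝ) * Real.sinc t ^ 2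

theorem sincConst_pos : 0 < sincConst := by
  unfold sincConst
  have hi := integrableOn_rpow_mul_sinc_sq one_pos
  simp only [one_mul] at hi
  rw [setIntegral_pos_iff_support_of_nonneg_ae _ hi]
  · refine lt_of_lt_of_le ?_ (measure_mono (s := Set.Ioo 0 1) fun t ht => ?_)
    · simp
    · refine ⟨?_, ht.1⟩
      have h1 : 0 < Real.sin t :=
        Real.sin_pos_of_pos_of_lt_pi ht.1 (by linarith [ht.2, Real.pi_gt_three])
      have h2 : 0 < t ^ (-(1 / 2) : ℝ) := Real.rpow_pos_of_pos ht.1 _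
      have ht0 := ht.1
      rw [Function.mem_support, Real.sinc_of_ne_zero ht.1.ne']
      positivity
  · filter_upwards [ae_restrict_mem measurableSet_Ioi] with t ht
    have : 0 ≤ t ^ (-(1 / 2) : ℝ) := Real.rpow_nonneg (le_of_lt ht) _
    simp only [Pi.zero_apply]
    positivity

/-- By scaling, `k^{-1/2}` is a superposition of the multipliers `sinc (k t) ^ 2` of the averages
applied twice. The square makes the constant manifestly positive. -/
theorem integral_rpow_mul_sinc_sq {k : ℝ} (hk : 0 < k) :
    ∫ t in Set.Ioi (0 : ℝ), t ^ (-(1 / 2) : ℝ) * Real.sinc (k * t) ^ 2 =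
      sincConst * k ^ (-(1 / 2) : ℝ) := by
  have h := integral_comp_mul_left_Ioi (fun t : ℝ => t ^ (-(1 / 2) : ℝ) * Real.sinc t ^ 2) 0 hk
  rw [mul_zero, smul_eq_mul] at h
  have e : ∫ t in Set.Ioi (0 : ℝ), (k * t) ^ (-(1 / 2) : ℝ) * Real.sinc (k * t) ^ 2 =
      k ^ (-(1 / 2) : ℝ) *
        ∫ t in Set.Ioi (0 : ℝ), t ^ (-(1 / 2) : ℝ) * Real.sinc (k * t) ^ 2 := by
    rw [← integral_const_mul]
    refine setIntegral_congr_fun measurableSet_Ioi fun t ht => ?_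
    rw [Real.mul_rpow hk.le (le_of_lt ht), mul_assoc]
  rw [e] at h
  have h0 : 0 < k ^ (-(1 / 2) : ℝ) := Real.rpow_pos_of_pos hk _
  have hsq : k ^ (-(1 / 2) : ℝ) * k ^ (-(1 / 2) : ℝ) = k⁻¹ := by
    rw [← Real.rpow_add hk, ← Real.rpow_neg_one]; norm_num
  refine mul_left_cancel₀ h0.ne' ?_
  rw [h, ← hsq, sincConst]; ring

theorem HolderBound.abs_sub_zero_le {β M : ℝ} {f : ℝ → ℝ} (hf : HolderBound β M f) (hβ : 0 ≤ β)
    (hβ' : β ≤ 1) {x : ℝ} (hx : x ∈ Set.Icc (-Real.pi) Real.pi) : |f x - f 0| ≤ M * Real.pi := by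
  have hM := hf.nonneg
  refine (hf x 0).trans (mul_le_mul_of_nonneg_left ?_ hM)
  rw [sub_zero]
  calc |x| ^ β ≤ Real.pi ^ β := Real.rpow_le_rpow (abs_nonneg _) (abs_le.2 hx) hβ
    _ ≤ Real.pi ^ (1 : ℝ) := Real.rpow_le_rpow_of_exponent_le (by linarith [Real.pi_gt_three]) hβ'
    _ = Real.pi := Real.rpow_one _

theorem HolderBound.abs_cosCoeff_le {β M : ℝ} {f : ℝ → ℝ} (hf : HolderBound β M f) (hβ : 0 ≤ β)
    (hβ' : β ≤ 1) (hc : Continuous f) {k : ℕ} (hk : k ≠ 0) :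
    |cosCoeff f k| ≤ 2 * (M * Real.pi) :=
  Whitham.abs_cosCoeff_le hc (fun _ hx => hf.abs_sub_zero_le hβ hβ' hx) hk

theorem hasSum_avg_avg {β M : ℝ} {f : ℝ → ℝ} (hf : HolderBound β M f) (hβ : 0 ≤ β)
    (hβ' : β ≤ 1) (hc : Continuous f)
    (hp : Function.Periodic f (2 * Real.pi)) (he : Function.Even f) {t : ℝ} (ht : 0 < t) (x : ℝ) :
    HasSum (fun k : ℕ => cosCoeff f k * Real.sinc (k * t) ^ 2 * Real.cos (k * x))
      (avg t (avg t f) x) := by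
  have e : cosCoeff (avg t (avg t f)) = fun k : ℕ => cosCoeff f k * Real.sinc (k * t) ^ 2 := by
    funext k
    rw [cosCoeff_avg ht (continuous_avg t hc) (periodic_avg t hp) (even_avg t he),
      cosCoeff_avg ht hc hp he]
    ring
  have hs : Summable (cosCoeff (avg t (avg t f))) := by
    rw [e, ← summable_nat_add_iff 1]
    have h1 : Summable fun k : ℕ => 2 * (M * Real.pi) * (t ^ 2)⁻¹ * (((k + 1 : ℕ) : ℝ) ^ 2)⁻¹ :=
      ((summable_nat_add_iff 1).2 (Real.summable_nat_pow_inv.2 one_lt_two)).mul_left _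
    refine Summable.of_norm_bounded h1 fun k => ?_
    have hk : ((k + 1 : ℕ) : ℝ) ≠ 0 := by positivity
    rw [norm_mul, Real.norm_eq_abs, Real.norm_eq_abs, abs_of_nonneg (sq_nonneg (Real.sinc _))]
    calc |cosCoeff f (k + 1)| * Real.sinc ((k + 1 : ℕ) * t) ^ 2
        ≤ 2 * (M * Real.pi) * ((((k + 1 : ℕ) : ℝ) * t) ^ 2)⁻¹ :=
          mul_le_mul (hf.abs_cosCoeff_le hβ hβ' hc (Nat.succ_ne_zero k))
            (sinc_sq_le_inv_sq (by positivity)) (sq_nonneg _)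
            (by have := hf.nonneg; positivity)
      _ = _ := by rw [mul_pow, mul_inv]; ring
  have := hasSum_cosCoeff (continuous_avg t (continuous_avg t hc))
    (periodic_avg t (periodic_avg t hp)) (even_avg t (even_avg t he)) hs x
  simpa only [e] using this

/-- The increments of `∑ a_k k^{-1/2} cos (k x)` (a half-order fractional integral of `f`): small
averaging radii are controlled by the Hölder continuity of the averages, large ones by their
gradient bound. -/
theorem abs_tsum_fractional_le {β M : ℝ} {f : ℝ → ℝ} (hf : HolderBound β M f) (hβ : 0 ≤ β)
    (hβ' : β < 1 / 2) (hc : Continuous f)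
    (hp : Function.Periodic f (2 * Real.pi)) (he : Function.Even f)
    (hs : Summable fun k : ℕ => |cosCoeff f k| * (k : ℝ) ^ (-(1 / 2) : ℝ))
    (x : ℝ) {h : ℝ} (hh : 0 < h) :
    |∑' k : ℕ, cosCoeff f k * (k : ℝ) ^ (-(1 / 2) : ℝ) *
        (Real.cos (k * (x + h)) - Real.cos (k * x))| ≤
      sincConst⁻¹ * (2 + (1 / 2 - β)⁻¹) * M * h ^ (β + 1 / 2) := by
  have hM := hf.nonneg
  have hc0 := sincConst_pos
  set D : ℕ → ℝ := fun k => Real.cos (k * (x + h)) - Real.cos (k * x) with hD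
  have hD0 : D 0 = 0 := by simp [hD]
  have hD2 : ∀ k, |D k| ≤ 2 := fun k => by
    have h1 := Real.abs_cos_le_one (k * (x + h))
    have h2 := Real.abs_cos_le_one (k * x)
    exact (abs_sub _ _).trans (by linarith)
  let F : ℕ → ℝ → ℝ := fun k t =>
    cosCoeff f k * D k * (t ^ (-(1 / 2) : ℝ) * Real.sinc (k * t) ^ 2)
  have hFi : ∀ k, Integrable (F k) (volume.restrict (Set.Ioi 0)) := fun k => by
    rcases Nat.eq_zero_or_pos k with rfl | hk
    · simp [F, hD0]
    · exact (integrableOn_rpow_mul_sinc_sq (Nat.cast_pos.2 hk)).const_mul _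
  have hFint : ∀ k, ∫ t in Set.Ioi (0 : ℝ), F k t =
      sincConst * (cosCoeff f k * (k : ℝ) ^ (-(1 / 2) : ℝ) * D k) := fun k => by
    rcases Nat.eq_zero_or_pos k with rfl | hk
    · simp [F, hD0]
    · simp only [F]
      rw [integral_const_mul, integral_rpow_mul_sinc_sq (Nat.cast_pos.2 hk)]
      ring
  have hFnorm : ∀ k, ∫ t in Set.Ioi (0 : ℝ), ‖F k t‖ =
      sincConst * (|cosCoeff f k| * (k : ℝ) ^ (-(1 / 2) : ℝ) * |D k|) := fun k => by
    rcases Nat.eq_zero_or_pos k with rfl | hk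
    · simp [F, hD0]
    · have : ∀ t ∈ Set.Ioi (0 : ℝ), ‖F k t‖ =
          |cosCoeff f k * D k| * (t ^ (-(1 / 2) : ℝ) * Real.sinc (k * t) ^ 2) := fun t ht => by
        have : 0 ≤ t ^ (-(1 / 2) : ℝ) := Real.rpow_nonneg (le_of_lt ht) _
        simp only [F, Real.norm_eq_abs]
        rw [abs_mul _ (_ * _), abs_of_nonneg (by positivity : 0 ≤ t ^ (-(1 / 2) : ℝ) * _)]
      rw [setIntegral_congr_fun measurableSet_Ioi this, integral_const_mul,
        integral_rpow_mul_sinc_sq (Nat.cast_pos.2 hk), abs_mul]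
      ring
  have hFs : Summable fun k => ∫ t in Set.Ioi (0 : ℝ), ‖F k t‖ := by
    simp only [hFnorm]
    refine Summable.mul_left _ (Summable.of_nonneg_of_le (fun k => by positivity) (fun k => ?_)
      (hs.mul_right 2))
    exact mul_le_mul_of_nonneg_left (hD2 k) (by positivity)
  have key := hasSum_integral_of_summable_integral_norm hFi hFs
  simp only [hFint] at key
  have hts : ∀ t ∈ Set.Ioi (0 : ℝ), ∑' k, F k t =
      t ^ (-(1 / 2) : ℝ) * (avg t (avg t f) (x + h) - avg t (avg t f) x) := fun t ht => by
    have h1 := ((hasSum_avg_avg hf hβ (by linarith) hc hp he ht (x + h)).sub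
      (hasSum_avg_avg hf hβ (by linarith) hc hp he ht x)).mul_left (t ^ (-(1 / 2) : ℝ))
    rw [← h1.tsum_eq]
    refine tsum_congr fun k => ?_
    simp only [F, hD]; ring
  rw [setIntegral_congr_fun measurableSet_Ioi hts] at key
  -- `G` dominates the integrand: Hölder bound for `t ≤ h`, gradient bound for `t > h`
  let G : ℝ → ℝ := fun t => if t ≤ h then M * h ^ β * t ^ (-(1 / 2) : ℝ)
    else M * h * t ^ (β - 3 / 2)
  have hG1 : Set.EqOn G (fun t => M * h ^ β * t ^ (-(1 / 2) : ℝ)) (Set.Ioc 0 h) := fun t ht => by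
    simp only [G, if_pos ht.2]
  have hG2 : Set.EqOn G (fun t => M * h * t ^ (β - 3 / 2)) (Set.Ioi h) := fun t ht => by
    simp only [G, if_neg (not_le.2 (Set.mem_Ioi.1 ht))]
  have hGi1 : IntegrableOn G (Set.Ioc 0 h) :=
    IntegrableOn.congr_fun ((integrableOn_rpow_Ioc (by norm_num) h).const_mul _)
      hG1.symm measurableSet_Ioc
  have hGi2 : IntegrableOn G (Set.Ioi h) :=
    IntegrableOn.congr_fun ((integrableOn_Ioi_rpow_of_lt (by linarith) hh).const_mul _)
      hG2.symm measurableSet_Ioi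
  have hGi : IntegrableOn G (Set.Ioi 0) := by
    rw [← Set.Ioc_union_Ioi_eq_Ioi hh.le]; exact hGi1.union hGi2
  have hGint : ∫ t in Set.Ioi (0 : ℝ), G t = (2 + (1 / 2 - β)⁻¹) * M * h ^ (β + 1 / 2) := by
    rw [← Set.Ioc_union_Ioi_eq_Ioi hh.le, setIntegral_union
      (Set.Ioc_disjoint_Ioi le_rfl) measurableSet_Ioi hGi1 hGi2,
      setIntegral_congr_fun measurableSet_Ioc hG1, setIntegral_congr_fun measurableSet_Ioi hG2,
      integral_const_mul, integral_const_mul, integral_Ioi_rpow_of_lt (by linarith) hh,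
      ← intervalIntegral.integral_of_le hh.le, integral_rpow (Or.inl (by norm_num))]
    have e1 : h ^ (β + 1 / 2) = h ^ β * h ^ ((1 : ℝ) / 2) := Real.rpow_add hh _ _
    have e2 : h ^ (β + 1 / 2) = h * h ^ (β - 3 / 2 + 1) := by
      rw [← Real.rpow_one_add' hh.le (by linarith)]; congr 1; ring
    rw [show (-(1 / 2) : ℝ) + 1 = 1 / 2 by norm_num, Real.zero_rpow (by norm_num : (1 : ℝ) / 2 ≠ 0)]
    have h3 : (1 / 2 - β) ≠ 0 := by linarith
    have h4 : β - 3 / 2 + 1 = -(1 / 2 - β) := by ring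
    have e3 : -h ^ (β - 3 / 2 + 1) / (β - 3 / 2 + 1) = h ^ (β - 3 / 2 + 1) * (1 / 2 - β)⁻¹ := by
      nth_rw 2 [h4]
      rw [neg_div_neg_eq, div_eq_mul_inv]
    rw [e3]
    calc _ = 2 * M * (h ^ β * h ^ ((1 : ℝ) / 2)) +
          (1 / 2 - β)⁻¹ * M * (h * h ^ (β - 3 / 2 + 1)) := by ring
      _ = _ := by rw [← e1, ← e2]; ring
  have hbound : |∫ t in Set.Ioi (0 : ℝ),
      t ^ (-(1 / 2) : ℝ) * (avg t (avg t f) (x + h) - avg t (avg t f) x)| ≤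
      (2 + (1 / 2 - β)⁻¹) * M * h ^ (β + 1 / 2) := by
    rw [← hGint, ← Real.norm_eq_abs]
    refine norm_integral_le_of_norm_le hGi ?_
    filter_upwards [ae_restrict_mem measurableSet_Ioi] with t ht
    have ht0 : (0 : ℝ) < t := ht
    have h0 : 0 ≤ t ^ (-(1 / 2) : ℝ) := Real.rpow_nonneg ht0.le _
    have hA := hf.avg ht0 hc
    rw [Real.norm_eq_abs, abs_mul, abs_of_nonneg h0]
    by_cases hth : t ≤ h
    · simp only [G, if_pos hth]
      have := (hA.avg ht0 (continuous_avg t hc)) (x + h) x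
      rw [add_sub_cancel_left, abs_of_pos hh] at this
      calc _ ≤ t ^ (-(1 / 2) : ℝ) * (M * h ^ β) := by gcongr
        _ = _ := by ring
    · simp only [G, if_neg hth]
      have := hA.abs_avg_add_sub_le ht0 (continuous_avg t hc) hh.le x
      have h2 : (2 * t) ^ (β - 1) ≤ t ^ (β - 1) :=
        Real.rpow_le_rpow_of_nonpos ht0 (by linarith) (by linarith)
      calc _ ≤ t ^ (-(1 / 2) : ℝ) * (M * h * t ^ (β - 1)) := by
            gcongr
            exact this.trans (by gcongr)
        _ = M * h * (t ^ (-(1 / 2) : ℝ) * t ^ (β - 1)) := by ring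
        _ = _ := by rw [← Real.rpow_add ht0]; congr 2; ring
  rw [← key.tsum_eq, tsum_mul_left, abs_mul, abs_of_pos hc0] at hbound
  calc _ = sincConst⁻¹ * (sincConst * |∑' k : ℕ, cosCoeff f k * (k : ℝ) ^ (-(1 / 2) : ℝ) * D k|) := by
        rw [← mul_assoc, inv_mul_cancel₀ hc0.ne', one_mul]
    _ ≤ sincConst⁻¹ * ((2 + (1 / 2 - β)⁻¹) * M * h ^ (β + 1 / 2)) := by gcongr
    _ = _ := by ring

/-! ### The Whitham symbol and the smoothing estimate -/

theorem rpow_neg_half_le_one {k : ℕ} (hk : k ≠ 0) : (k : ℝ) ^ (-(1 / 2) : ℝ) ≤ 1 :=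
  Real.rpow_le_one_of_one_le_of_nonpos (by exact_mod_cast Nat.one_le_iff_ne_zero.2 hk) (by norm_num)

theorem one_sub_tanh (x : ℝ) : 1 - Real.tanh x = 2 / (Real.exp (2 * x) + 1) := by
  rw [Real.tanh_eq_sinh_div_cosh, Real.sinh_eq, Real.cosh_eq]
  have h : Real.exp (2 * x) = Real.exp x * Real.exp x := by rw [← Real.exp_add]; ring_nf
  rw [h, Real.exp_neg]
  have := Real.exp_pos x
  field_simp
  ring

theorem symbol_eq {k : ℕ} (hk : k ≠ 0) :
    symbol k = Real.sqrt (Real.tanh k) * (k : ℝ) ^ (-(1 / 2) : ℝ) := by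
  rw [symbol, if_neg hk, Real.sqrt_div' _ (Nat.cast_nonneg k), div_eq_mul_inv,
    Real.rpow_neg (Nat.cast_nonneg k), ← Real.sqrt_eq_rpow]

theorem half_le_tanh {k : ℕ} (hk : k ≠ 0) : 1 / 2 ≤ Real.tanh k := by
  have h1 : (1 : ℝ) ≤ k := by exact_mod_cast Nat.one_le_iff_ne_zero.2 hk
  have h2 := Real.add_one_le_exp (2 * (k : ℝ))
  have h3 : 2 / (Real.exp (2 * (k : ℝ)) + 1) ≤ 1 / 2 := by
    rw [div_le_div_iff₀ (by positivity) (by norm_num)]; linarith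
  linarith [one_sub_tanh k]

theorem tanh_le_sqrt_tanh {k : ℕ} (hk : k ≠ 0) : Real.tanh k ≤ Real.sqrt (Real.tanh k) := by
  refine Real.le_sqrt_of_sq_le ?_
  have h1 := half_le_tanh hk
  have h2 : 0 ≤ 1 - Real.tanh k := by rw [one_sub_tanh]; positivity
  nlinarith

theorem rpow_neg_half_le_symbol {k : ℕ} (hk : k ≠ 0) :
    (k : ℝ) ^ (-(1 / 2) : ℝ) ≤ 2 * symbol k := by
  rw [symbol_eq hk]
  have h1 := (half_le_tanh hk).trans (tanh_le_sqrt_tanh hk)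
  have h2 : 0 ≤ (k : ℝ) ^ (-(1 / 2) : ℝ) := by positivity
  nlinarith

theorem symbol_nonneg (k : ℕ) : 0 ≤ symbol k := by
  unfold symbol; split_ifs
  · exact zero_le_one
  · exact Real.sqrt_nonneg _

theorem symbol_le {k : ℕ} (hk : k ≠ 0) : symbol k ≤ (k : ℝ) ^ (-(1 / 2) : ℝ) := by
  rw [symbol_eq hk]
  refine mul_le_of_le_one_left (by positivity) (Real.sqrt_le_one.2 ?_)
  have h2 : 0 ≤ 1 - Real.tanh k := by rw [one_sub_tanh]; positivity
  linarith

/-- The symbol differs from `k^{-1/2}` by a rapidly decaying remainder. -/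
theorem abs_symbol_sub_le {k : ℕ} (hk : k ≠ 0) :
    |symbol k - (k : ℝ) ^ (-(1 / 2) : ℝ)| ≤ 2 * ((k : ℝ) ^ 3)⁻¹ := by
  have hk0 : (0 : ℝ) < k := by exact_mod_cast Nat.pos_of_ne_zero hk
  rw [abs_sub_comm, abs_of_nonneg (sub_nonneg.2 (symbol_le hk)), symbol_eq hk]
  have h1 : 0 ≤ (k : ℝ) ^ (-(1 / 2) : ℝ) := by positivity
  have h2 := rpow_neg_half_le_one hk
  have h3 := tanh_le_sqrt_tanh hk
  have h4 : 1 - Real.tanh k ≤ 2 * ((k : ℝ) ^ 3)⁻¹ := by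
    rw [one_sub_tanh, div_eq_mul_inv]
    gcongr
    have := Real.pow_div_factorial_le_exp (2 * (k : ℝ)) (by positivity) 3
    simp only [Nat.factorial] at this
    norm_num at this
    have h5 : (0 : ℝ) < (k : ℝ) ^ 3 := by positivity
    nlinarith
  have h5 : 0 ≤ 1 - Real.tanh k := by rw [one_sub_tanh]; positivity
  nlinarith

theorem abs_cos_sub_cos_le_rpow {θ : ℝ} (h0 : 0 ≤ θ) (h1 : θ ≤ 1) (a b : ℝ) :
    |Real.cos a - Real.cos b| ≤ 2 * |a - b| ^ θ := by
  rcases le_total |a - b| 1 with h | h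
  · have h2 : |a - b| ≤ |a - b| ^ θ := by
      rcases eq_or_lt_of_le (abs_nonneg (a - b)) with h3 | h3
      · rw [← h3]; positivity
      · calc |a - b| = |a - b| ^ (1 : ℝ) := (Real.rpow_one _).symm
          _ ≤ _ := Real.rpow_le_rpow_of_exponent_ge h3 h h1
    have h3 : |Real.cos a - Real.cos b| ≤ |a - b| := Real.abs_cos_sub_cos_le a b
    have : 0 ≤ |a - b| ^ θ := by positivity
    linarith
  · have h2 : 1 ≤ |a - b| ^ θ := Real.one_le_rpow h h0
    have h3 := Real.abs_cos_le_one a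
    have h4 := Real.abs_cos_le_one b
    linarith [abs_sub (Real.cos a) (Real.cos b)]

theorem summable_of_isWhithamImage {f g : ℝ → ℝ} (h : IsWhithamImage f g) :
    Summable fun k : ℕ => cosCoeff f k * symbol k := by
  have := (h 0).summable
  simpa using this

theorem summable_abs_cosCoeff_mul_rpow {f g : ℝ → ℝ} (h : IsWhithamImage f g) :
    Summable fun k : ℕ => |cosCoeff f k| * (k : ℝ) ^ (-(1 / 2) : ℝ) := by
  refine Summable.of_nonneg_of_le (fun k => by positivity) (fun k => ?_)
    ((summable_of_isWhithamImage h).abs.mul_left 2)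
  rw [abs_mul, abs_of_nonneg (symbol_nonneg k), mul_left_comm]
  refine mul_le_mul_of_nonneg_left ?_ (abs_nonneg _)
  by_cases hk : k = 0
  · rw [hk, Nat.cast_zero, Real.zero_rpow (by norm_num)]
    linarith [symbol_nonneg 0]
  · exact rpow_neg_half_le_symbol hk

/-- The Whitham operator gains half a derivative on the Hölder scale, as long as the resulting
exponent stays below one. -/
theorem exists_holderBound_image {β : ℝ} (hβ : 0 ≤ β) (hβ' : β < 1 / 2) :
    ∃ C : ℝ, 0 ≤ C ∧ ∀ (f g : ℝ → ℝ) (M : ℝ), Continuous f → Function.Periodic f (2 * Real.pi) →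
      Function.Even f → HolderBound β M f → IsWhithamImage f g →
      HolderBound (β + 1 / 2) (C * M) g := by
  set S : ℝ := ∑' k : ℕ, ((k : ℝ) ^ 2)⁻¹ with hS
  have hSs : Summable fun k : ℕ => ((k : ℝ) ^ 2)⁻¹ := Real.summable_nat_pow_inv.2 one_lt_two
  have hS0 : 0 ≤ S := tsum_nonneg fun k => by positivity
  have hc0 := sincConst_pos
  have hβ2 : 0 < 1 / 2 - β := by linarith
  have hpi := Real.pi_pos
  refine ⟨sincConst⁻¹ * (2 + (1 / 2 - β)⁻¹) + 8 * Real.pi * S, by positivity, ?_⟩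
  intro f g M hc hp he hf hg
  have hM := hf.nonneg
  have main : ∀ x h : ℝ, 0 < h → |g (x + h) - g x| ≤
      (sincConst⁻¹ * (2 + (1 / 2 - β)⁻¹) + 8 * Real.pi * S) * M * h ^ (β + 1 / 2) := by
    intro x h hh
    have hs := summable_abs_cosCoeff_mul_rpow hg
    have h1 := abs_tsum_fractional_le hf hβ hβ' hc hp he hs x hh
    set D : ℕ → ℝ := fun k => Real.cos (k * (x + h)) - Real.cos (k * x) with hD
    have hD2 : ∀ k, |D k| ≤ 2 := fun k => by
      have h1 := Real.abs_cos_le_one (k * (x + h))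
      have h2 := Real.abs_cos_le_one (k * x)
      exact (abs_sub _ _).trans (by linarith)
    have hDk : ∀ k : ℕ, k ≠ 0 → |D k| ≤ 2 * ((k : ℝ) * h ^ (β + 1 / 2)) := fun k hk => by
      refine (abs_cos_sub_cos_le_rpow (θ := β + 1 / 2) (by linarith) (by linarith) _ _).trans ?_
      have hk1 : (1 : ℝ) ≤ k := by exact_mod_cast Nat.one_le_iff_ne_zero.2 hk
      rw [show (k : ℝ) * (x + h) - k * x = k * h by ring, abs_of_pos (by positivity),
        Real.mul_rpow (by positivity) hh.le]
      gcongr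
      calc (k : ℝ) ^ (β + 1 / 2) ≤ (k : ℝ) ^ (1 : ℝ) :=
            Real.rpow_le_rpow_of_exponent_le hk1 (by linarith)
        _ = k := Real.rpow_one _
    have hs1 : Summable fun k : ℕ => cosCoeff f k * (k : ℝ) ^ (-(1 / 2) : ℝ) * D k := by
      refine Summable.of_norm_bounded (hs.mul_right 2) fun k => ?_
      rw [norm_mul, norm_mul, Real.norm_eq_abs, Real.norm_eq_abs, Real.norm_eq_abs,
        abs_of_nonneg (by positivity : 0 ≤ (k : ℝ) ^ (-(1 / 2) : ℝ))]
      exact mul_le_mul_of_nonneg_left (hD2 k) (by positivity)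
    have hR : ∀ k : ℕ, ‖cosCoeff f k * (symbol k - (k : ℝ) ^ (-(1 / 2) : ℝ)) * D k‖ ≤
        8 * Real.pi * M * h ^ (β + 1 / 2) * ((k : ℝ) ^ 2)⁻¹ := fun k => by
      by_cases hk : k = 0
      · have : D k = 0 := by simp [hD, hk]
        rw [this, mul_zero, norm_zero]; positivity
      · have hk0 : (0 : ℝ) < k := by exact_mod_cast Nat.pos_of_ne_zero hk
        rw [norm_mul, norm_mul, Real.norm_eq_abs, Real.norm_eq_abs, Real.norm_eq_abs]
        calc _ ≤ (2 * (M * Real.pi)) * (2 * ((k : ℝ) ^ 3)⁻¹) *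
              (2 * ((k : ℝ) * h ^ (β + 1 / 2))) := by
              gcongr
              · exact hf.abs_cosCoeff_le hβ (by linarith) hc hk
              · exact abs_symbol_sub_le hk
              · exact hDk k hk
          _ = _ := by field_simp; ring
    have hRs := hSs.mul_left (8 * Real.pi * M * h ^ (β + 1 / 2))
    have hs2 := Summable.of_norm_bounded hRs hR
    have h2 := tsum_of_norm_bounded hRs.hasSum hR
    rw [tsum_mul_left, ← hS, Real.norm_eq_abs] at h2
    have h3 : g (x + h) - g x = (∑' k : ℕ, cosCoeff f k * (k : ℝ) ^ (-(1 / 2) : ℝ) * D k) +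
        ∑' k : ℕ, cosCoeff f k * (symbol k - (k : ℝ) ^ (-(1 / 2) : ℝ)) * D k := by
      rw [← ((hg (x + h)).sub (hg x)).tsum_eq, ← hs1.tsum_add hs2]
      refine tsum_congr fun k => ?_
      simp only [hD]; ring
    rw [h3]
    refine (abs_add_le _ _).trans ((add_le_add h1 h2).trans (le_of_eq ?_))
    ring
  intro x y
  rcases lt_trichotomy x y with h | h | h
  · have := main x (y - x) (by linarith)
    rwa [add_sub_cancel, abs_sub_comm (g y), ← abs_of_pos (sub_pos.2 h), abs_sub_comm y] at this
  · rw [h, sub_self, abs_zero]; positivity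
  · have := main y (x - y) (by linarith)
    rwa [add_sub_cancel, ← abs_of_pos (sub_pos.2 h)] at this

/-! ### Bernstein's summability criterion -/

/-- Bessel's inequality for the symmetric difference `f (x + h) - f (x - h)`. -/
theorem sum_sin_sq_mul_cosCoeff_sq_le {β M : ℝ} {f : ℝ → ℝ} (hf : HolderBound β M f)
    (hc : Continuous f) (hp : Function.Periodic f (2 * Real.pi)) (he : Function.Even f)
    {h : ℝ} (hh : 0 < h) (s : Finset ℕ) (hs : ∀ k ∈ s, k ≠ 0) :
    ∑ k ∈ s, Real.sin (k * h) ^ 2 * cosCoeff f k ^ 2 ≤ (M * (2 * h) ^ β) ^ 2 := by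
  have hpi := Real.pi_pos
  let d : ℝ → ℝ := fun x => f (x + h) - f (x - h)
  have hdc : Continuous d := by fun_prop
  have hp' : Function.Periodic (fun x => (d x : ℂ)) (2 * Real.pi) := fun x => by
    simp only [d]
    rw [show x + 2 * Real.pi + h = x + h + 2 * Real.pi by ring, hp,
      show x + 2 * Real.pi - h = x - h + 2 * Real.pi by ring, hp]
  let F : C(AddCircle (2 * Real.pi), ℂ) := ⟨hp'.lift, continuous_coinduced_dom.mpr (by
    change Continuous fun x => (d x : ℂ)
    fun_prop)⟩
  have hF : ∀ x : ℝ, F x = d x := fun x => hp'.lift_coe x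
  have hM := hf.nonneg
  have hnorm : ∀ z, ‖F z‖ ≤ M * (2 * h) ^ β := fun z => by
    induction z using QuotientAddGroup.induction_on with
    | H x =>
      have := hf (x + h) (x - h)
      rw [show x + h - (x - h) = 2 * h by ring, abs_of_pos (by positivity : 0 < 2 * h)] at this
      rw [show ((x : ℝ ⧸ AddSubgroup.zmultiples (2 * Real.pi)) : AddCircle (2 * Real.pi)) =
        ((x : ℝ) : AddCircle (2 * Real.pi)) from rfl, hF, Complex.norm_real, Real.norm_eq_abs]
      exact this
  have hpars := hasSum_sq_fourierCoeff (ContinuousMap.toLp (E := ℂ) 2 AddCircle.haarAddCircle ℂ F)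
  have hint : ∫ t : AddCircle (2 * Real.pi),
      ‖ContinuousMap.toLp (E := ℂ) 2 AddCircle.haarAddCircle ℂ F t‖ ^ 2
        ∂AddCircle.haarAddCircle ≤ (M * (2 * h) ^ β) ^ 2 := by
    have hae := ContinuousMap.coeFn_toLp (E := ℂ) (p := 2) AddCircle.haarAddCircle (𝕜 := ℂ) F
    calc _ ≤ ∫ _ : AddCircle (2 * Real.pi), (M * (2 * h) ^ β) ^ 2 ∂AddCircle.haarAddCircle := by
          refine integral_mono_of_nonneg (ae_of_all _ fun _ => by positivity)
            (integrable_const _) ?_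
          filter_upwards [hae] with z hz
          rw [hz]
          exact pow_le_pow_left₀ (norm_nonneg _) (hnorm z) 2
      _ = _ := by simp
  have hco : ∀ k : ℕ, k ≠ 0 → Real.sin (k * h) ^ 2 * cosCoeff f k ^ 2 ≤
      ‖fourierCoeff (ContinuousMap.toLp (E := ℂ) 2 AddCircle.haarAddCircle ℂ F) (k : ℤ)‖ ^ 2 := by
    intro k hk
    have hsin : ∫ x in (-Real.pi)..Real.pi, d x * Real.sin ((k : ℤ) * x) =
        -2 * Real.sin (k * h) * (Real.pi * cosCoeff f k) := by
      have e : ∀ x, d x * Real.sin ((k : ℤ) * x) =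
          f (x + h) * Real.sin (k * x) - f (x + -h) * Real.sin (k * x) := fun x => by
        simp only [d, Int.cast_natCast, sub_eq_add_neg]; ring
      simp only [e]
      rw [intervalIntegral.integral_sub (by apply Continuous.intervalIntegrable; fun_prop)
        (by apply Continuous.intervalIntegrable; fun_prop), integral_shift_mul_sin hc hp he,
        integral_shift_mul_sin hc hp he, cosCoeff_eq, if_neg hk, mul_neg, Real.sin_neg]
      field_simp
      ring
    rw [fourierCoeff_toLp, fourierCoeff_eq_intervalIntegral F k (-Real.pi)]
    simp only [hF]
    rw [show -Real.pi + 2 * Real.pi = Real.pi by ring, intervalIntegral_fourier_mul hdc, hsin,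
      ← mul_pow]
    refine sq_le_sq.2 ?_
    rw [abs_of_nonneg (norm_nonneg _)]
    refine le_trans (le_of_eq ?_) (Complex.abs_im_le_norm _)
    rw [Complex.real_smul, Complex.im_ofReal_mul, Complex.sub_im, Complex.ofReal_im,
      Complex.im_ofReal_mul, Complex.I_im]
    congr 1
    field_simp
    ring
  calc _ ≤ ∑ k ∈ s, ‖fourierCoeff (ContinuousMap.toLp (E := ℂ) 2 AddCircle.haarAddCircle ℂ F)
          (k : ℤ)‖ ^ 2 := Finset.sum_le_sum fun k hk => hco k (hs k hk)
    _ = ∑ n ∈ s.map Nat.castEmbedding, ‖fourierCoeff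
          (ContinuousMap.toLp (E := ℂ) 2 AddCircle.haarAddCircle ℂ F) (n : ℤ)‖ ^ 2 := by
        rw [Finset.sum_map]; rfl
    _ ≤ _ := (sum_le_hasSum _ (fun _ _ => by positivity) hpars).trans hint

/-- Bernstein: for a Hölder continuous even function, `∑ |a_k| k^{-1/2}` converges. -/
theorem summable_abs_cosCoeff_mul_rpow_of_holderBound {β M : ℝ} {f : ℝ → ℝ}
    (hf : HolderBound β M f) (hβ : 0 < β)
    (hc : Continuous f) (hp : Function.Periodic f (2 * Real.pi)) (he : Function.Even f) :
    Summable fun k : ℕ => |cosCoeff f k| * (k : ℝ) ^ (-(1 / 2) : ℝ) := by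
  have hM := hf.nonneg
  have hpi := Real.pi_pos
  set F : ℕ → ℝ := fun k => |cosCoeff f k| * (k : ℝ) ^ (-(1 / 2) : ℝ) with hFdef
  have hF0 : ∀ k, 0 ≤ F k := fun k => by positivity
  set r : ℝ := (1 / 2 : ℝ) ^ β with hr
  have hr0 : 0 ≤ r := by positivity
  have hr1 : r < 1 := Real.rpow_lt_one (by norm_num) (by norm_num) hβ
  set A : ℝ := 2 * (M * (Real.pi / 2) ^ β) with hA
  have block : ∀ j : ℕ, ∑ k ∈ Finset.Ico (2 ^ j) (2 ^ (j + 1)), F k ≤ A * r ^ j := by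
    intro j
    set I : Finset ℕ := Finset.Ico (2 ^ j) (2 ^ (j + 1)) with hI
    have hne : ∀ k ∈ I, k ≠ 0 := fun k hk => by
      have := (Finset.mem_Ico.1 (hI ▸ hk)).1
      have h2 : 0 < 2 ^ j := by positivity
      omega
    -- with this step the phases `k h` of the block lie in `[π/4, π/2]`, where `sin ^ 2 ≥ 1/2`
    set h : ℝ := Real.pi / 4 * (1 / 2) ^ j with hh
    have hh0 : 0 < h := by positivity
    have hbes := sum_sin_sq_mul_cosCoeff_sq_le hf hc hp he hh0 _ hne
    have hsin : ∀ k ∈ I, 1 / 2 ≤ Real.sin (k * h) ^ 2 := by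
      intro k hk
      obtain ⟨h1, h2⟩ := Finset.mem_Ico.1 (hI ▸ hk)
      have h1' : (2 : ℝ) ^ j ≤ k := by exact_mod_cast h1
      have h2' : (k : ℝ) ≤ 2 * 2 ^ j := by
        rw [← pow_succ']; exact_mod_cast h2.le
      have hz : (2 : ℝ) ^ j * (1 / 2) ^ j = 1 := by rw [← mul_pow]; norm_num
      have l1 : Real.pi / 4 ≤ k * h := by
        calc Real.pi / 4 = 2 ^ j * h := by
              rw [hh, mul_left_comm, hz, mul_one]
          _ ≤ _ := by gcongr
      have l2 : k * h ≤ Real.pi / 2 := by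
        calc k * h ≤ 2 * 2 ^ j * h := by gcongr
          _ = 2 * (Real.pi / 4) * (2 ^ j * (1 / 2) ^ j) := by rw [hh]; ring
          _ = _ := by rw [hz]; ring
      have := Real.sin_le_sin_of_le_of_le_pi_div_two (by linarith) l2 l1
      rw [Real.sin_pi_div_four] at this
      calc (1 / 2 : ℝ) = (√2 / 2) ^ 2 := by rw [div_pow, Real.sq_sqrt (by norm_num)]; norm_num
        _ ≤ _ := pow_le_pow_left₀ (by positivity) this 2
    have hsq : ∑ k ∈ I, |cosCoeff f k| ^ 2 ≤
        2 * (M * (2 * h) ^ β) ^ 2 := by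
      calc _ ≤ ∑ k ∈ I,
            2 * (Real.sin (k * h) ^ 2 * cosCoeff f k ^ 2) := by
            refine Finset.sum_le_sum fun k hk => ?_
            rw [sq_abs]
            nlinarith [hsin k hk, sq_nonneg (cosCoeff f k)]
        _ ≤ _ := by rw [← Finset.mul_sum]; gcongr
    have hinv : ∑ k ∈ I, ((k : ℝ) ^ (-(1 / 2) : ℝ)) ^ 2 ≤ 1 := by
      calc _ ≤ ∑ k ∈ I, ((2 : ℝ) ^ j)⁻¹ := by
            refine Finset.sum_le_sum fun k hk => ?_
            have h1 : (2 : ℝ) ^ j ≤ k := by exact_mod_cast (Finset.mem_Ico.1 (hI ▸ hk)).1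
            have h2 : (0 : ℝ) < 2 ^ j := by positivity
            rw [← Real.rpow_natCast, ← Real.rpow_mul (Nat.cast_nonneg k)]
            norm_num
            rw [Real.rpow_neg_one]
            exact inv_anti₀ h2 h1
        _ = 1 := by
            rw [Finset.sum_const, hI, Nat.card_Ico, pow_succ, mul_two, Nat.add_sub_cancel,
              nsmul_eq_mul]
            push_cast
            exact mul_inv_cancel₀ (by positivity)
    have hcs := Finset.sum_mul_sq_le_sq_mul_sq (I)
      (fun k => |cosCoeff f k|) (fun k : ℕ => (k : ℝ) ^ (-(1 / 2) : ℝ))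
    have h2h : (2 * h) ^ β = (Real.pi / 2) ^ β * r ^ j := by
      rw [hh, hr, ← Real.rpow_natCast ((1 / 2 : ℝ) ^ β), ← Real.rpow_mul (by norm_num),
        mul_comm β, Real.rpow_mul (by norm_num), Real.rpow_natCast,
        ← Real.mul_rpow (by positivity) (by positivity)]
      congr 1; ring
    refine le_of_abs_le (abs_le_of_sq_le_sq ?_ (by positivity))
    calc _ ≤ _ := hcs
      _ ≤ (2 * (M * (2 * h) ^ β) ^ 2) * 1 :=
        mul_le_mul hsq hinv (Finset.sum_nonneg fun _ _ => by positivity) (by positivity)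
      _ ≤ (A * r ^ j) ^ 2 := by
        rw [h2h, hA]
        nlinarith [sq_nonneg (M * ((Real.pi / 2) ^ β * r ^ j))]
  have partial_sum : ∀ J : ℕ, ∑ k ∈ Finset.range (2 ^ J), F k ≤ F 0 + A * (1 - r)⁻¹ := by
    have hgeo : ∀ J : ℕ, ∑ k ∈ Finset.range (2 ^ J), F k ≤
        F 0 + ∑ j ∈ Finset.range J, A * r ^ j := by
      intro J
      induction J with
      | zero => simp
      | succ J ih =>
        rw [Finset.range_eq_Ico, ← Finset.sum_Ico_consecutive F (Nat.zero_le (2 ^ J))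
          (Nat.pow_le_pow_right (by norm_num) (Nat.le_succ J)), ← Finset.range_eq_Ico,
          Finset.sum_range_succ]
        linarith [block J]
    intro J
    refine (hgeo J).trans ?_
    rw [← Finset.mul_sum]
    have hA0 : 0 ≤ A := by positivity
    gcongr
    rw [← tsum_geometric_of_lt_one hr0 hr1]
    exact (summable_geometric_of_lt_one hr0 hr1).sum_le_tsum _ fun _ _ => by positivity
  refine summable_of_sum_range_le (c := F 0 + A * (1 - r)⁻¹) hF0 fun n => ?_
  refine le_trans (Finset.sum_le_sum_of_subset_of_nonneg ?_ fun _ _ _ => hF0 _) (partial_sum n)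
  exact Finset.range_mono n.lt_two_pow_self.le

/-! ### Hölder estimates for Whitham solutions -/

theorem holderOnWith_of_abs_le {f : ℝ → ℝ} {M : ℝ} {α : ℝ≥0} {U : Set ℝ} (hM : 0 ≤ M)
    (h : ∀ x ∈ U, ∀ y ∈ U, |f x - f y| ≤ M * |x - y| ^ (α : ℝ)) :
    HolderOnWith M.toNNReal α f U := fun x hx y hy => by
  rw [edist_dist, edist_dist, Real.dist_eq, Real.dist_eq,
    ENNReal.ofReal_rpow_of_nonneg (abs_nonneg _) α.coe_nonneg]
  change _ ≤ ENNReal.ofReal M * _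
  rw [← ENNReal.ofReal_mul hM]
  exact ENNReal.ofReal_le_ofReal (h x hx y hy)

theorem holderBound_zero_of_abs_le {f : ℝ → ℝ} {B : ℝ} (hB : ∀ x, |f x| ≤ B) :
    HolderBound 0 (2 * B) f := fun x y => by
  rw [Real.rpow_zero, mul_one]
  linarith [abs_sub (f x) (f y), hB x, hB y]

theorem HolderBound.of_le {α β M B : ℝ} {f : ℝ → ℝ} (h : HolderBound β M f)
    (hB : ∀ x, |f x| ≤ B) (hα : 0 ≤ α) (hαβ : α ≤ β) : HolderBound α (M + 2 * B) f := fun x y => by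
  have hM := h.nonneg
  have hB0 := (abs_nonneg _).trans (hB 0)
  rcases eq_or_ne x y with rfl | hxy
  · rw [sub_self, abs_zero]; positivity
  have hd : 0 < |x - y| := abs_pos.2 (sub_ne_zero.2 hxy)
  rcases le_total |x - y| 1 with h1 | h1
  · refine (h x y).trans ?_
    have := Real.rpow_le_rpow_of_exponent_ge hd h1 hαβ
    gcongr
    linarith
  · have h2 := Real.one_le_rpow h1 hα
    have h3 := holderBound_zero_of_abs_le hB x y
    rw [Real.rpow_zero, mul_one] at h3
    nlinarith

/-- Completing the square in the equation: `u = μ / 2 - φ ≥ 0` satisfies `u ^ 2 = μ ^ 2 / 4 - L φ`,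
so increments of `φ` are at most the square root of those of `L φ`. -/
theorem sq_abs_sub_le {a b m : ℝ} (ha : a ≤ m / 2) (hb : b ≤ m / 2) :
    |a - b| ^ 2 ≤ |(m * a - a ^ 2) - (m * b - b ^ 2)| := by
  rw [show (m * a - a ^ 2) - (m * b - b ^ 2) = (a - b) * (m - a - b) by ring, abs_mul, sq]
  refine mul_le_mul_of_nonneg_left ?_ (abs_nonneg _)
  rw [abs_of_nonneg (by linarith : 0 ≤ m - a - b)]
  exact abs_le.2 ⟨by linarith, by linarith⟩

/-- One step of the regularity gain: `φ ∈ C^β` gives `L φ ∈ C^{β + 1/2}`, and the square root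
halves the exponent. -/
theorem exists_holderBound_solution {β : ℝ} (hβ : 0 ≤ β) (hβ' : β < 1 / 2) :
    ∃ C : ℝ, 0 ≤ C ∧ ∀ (φ : ℝ → ℝ) (μ M : ℝ), IsSolution φ μ → (∀ x, φ x ≤ μ / 2) →
      HolderBound β M φ → HolderBound (β / 2 + 1 / 4) (Real.sqrt (C * M)) φ := by
  obtain ⟨C, hC, h⟩ := exists_holderBound_image hβ hβ'
  refine ⟨C, hC, fun φ μ M hs hle hb x y => ?_⟩
  have hM := hb.nonneg
  have h1 := h φ _ M hs.continuous hs.periodic hs.even hb hs.equation x y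
  have h2 := (sq_abs_sub_le (hle x) (hle y)).trans h1
  refine le_of_abs_le (abs_le_of_sq_le_sq (h2.trans (le_of_eq ?_)) (by positivity))
  rw [mul_pow, Real.sq_sqrt (by positivity), ← Real.rpow_natCast (_ ^ _),
    ← Real.rpow_mul (abs_nonneg _)]
  congr 2
  push_cast; ring

theorem exists_mem_Icc_eq {f : ℝ → ℝ} (hp : Function.Periodic f (2 * Real.pi)) (x : ℝ) :
    ∃ y ∈ Set.Icc (-Real.pi) Real.pi, f x = f y := by
  obtain ⟨y, hy, h⟩ := hp.exists_mem_Ico Real.two_pi_pos x (-Real.pi)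
  exact ⟨y, ⟨hy.1, by linarith [hy.2]⟩, h⟩

theorem exists_abs_max {f : ℝ → ℝ} (hc : Continuous f) (hp : Function.Periodic f (2 * Real.pi)) :
    ∃ z ∈ Set.Icc (-Real.pi) Real.pi, ∀ x, |f x| ≤ |f z| := by
  have hpi := Real.pi_pos
  obtain ⟨z, hz, hmax⟩ := isCompact_Icc.exists_isMaxOn (s := Set.Icc (-Real.pi) Real.pi)
    ⟨0, by constructor <;> linarith⟩ hc.abs.continuousOn
  refine ⟨z, hz, fun x => ?_⟩
  obtain ⟨y, hy, h⟩ := exists_mem_Icc_eq hp x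
  rw [h]; exact hmax hy

/-- A priori bound: at a maximum of `|φ|` the quadratic term of the equation dominates, since `L φ`
is bounded linearly in `φ`. -/
theorem exists_abs_solution_le : ∃ B : ℝ, ∀ (φ : ℝ → ℝ) (μ : ℝ), IsSolution φ μ →
    μ ∈ Set.Icc (0 : ℝ) 1 → ∀ x, |φ x| ≤ B := by
  obtain ⟨C, hC, h⟩ := exists_holderBound_image le_rfl (by norm_num : (0 : ℝ) < 1 / 2)
  have hpi := Real.pi_pos
  refine ⟨2 + 2 * C * (2 * Real.pi) ^ (1 / 2 : ℝ), fun φ μ hs hμ => ?_⟩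
  obtain ⟨z, hz, hmax⟩ := exists_abs_max hs.continuous hs.periodic
  set N := |φ z| with hN
  have hN0 : 0 ≤ N := abs_nonneg _
  set g : ℝ → ℝ := fun x => μ * φ x - φ x ^ 2 with hg
  have hφc := hs.continuous
  have hgc : Continuous g := by fun_prop
  have hosc := h φ g _ hs.continuous hs.periodic hs.even (holderBound_zero_of_abs_le hmax)
    hs.equation
  rw [zero_add] at hosc
  -- `g` and `φ` have the same mean, because the symbol is `1` at frequency zero
  have hmean : ∫ x in (-Real.pi)..Real.pi, g x = ∫ x in (-Real.pi)..Real.pi, φ x := by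
    have h1 := cosCoeff_eq_of_hasSum (summable_of_isWhithamImage hs.equation) hs.equation 0
    rw [← hg] at h1
    simp only [cosCoeff, symbol, if_true, mul_one] at h1
    exact mul_left_cancel₀ (by positivity) h1
  have hmeanle : |∫ x in (-Real.pi)..Real.pi, g x| ≤ N * (2 * Real.pi) := by
    rw [hmean]
    have := intervalIntegral.norm_integral_le_of_norm_le_const (a := -Real.pi) (b := Real.pi)
      (C := N) (f := φ) (fun x _ => hmax x)
    rwa [Real.norm_eq_abs, show Real.pi - -Real.pi = 2 * Real.pi by ring,
      abs_of_pos (by positivity : 0 < 2 * Real.pi)] at this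
  have hdiff : |∫ x in (-Real.pi)..Real.pi, (g z - g x)| ≤
      C * (2 * N) * (2 * Real.pi) ^ (1 / 2 : ℝ) * (2 * Real.pi) := by
    have := intervalIntegral.norm_integral_le_of_norm_le_const (a := -Real.pi) (b := Real.pi)
      (C := C * (2 * N) * (2 * Real.pi) ^ (1 / 2 : ℝ)) (f := fun x => g z - g x) (fun x hx => by
        rw [Set.uIoc_of_le (by linarith)] at hx
        refine (hosc z x).trans ?_
        gcongr
        exact abs_le.2 ⟨by linarith [hz.1, hx.2], by linarith [hz.2, hx.1]⟩)
    rwa [Real.norm_eq_abs, show Real.pi - -Real.pi = 2 * Real.pi by ring,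
      abs_of_pos (by positivity : 0 < 2 * Real.pi)] at this
  have hgz : |g z| ≤ C * (2 * N) * (2 * Real.pi) ^ (1 / 2 : ℝ) + N := by
    rw [intervalIntegral.integral_sub intervalIntegrable_const (hgc.intervalIntegrable _ _),
      intervalIntegral.integral_const, smul_eq_mul,
      show Real.pi - -Real.pi = 2 * Real.pi by ring] at hdiff
    have h1 : |2 * Real.pi * g z| ≤ (C * (2 * N) * (2 * Real.pi) ^ (1 / 2 : ℝ) + N) *
        (2 * Real.pi) := by
      calc |2 * Real.pi * g z| = |(2 * Real.pi * g z - ∫ x in (-Real.pi)..Real.pi, g x) +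
            ∫ x in (-Real.pi)..Real.pi, g x| := by rw [sub_add_cancel]
        _ ≤ _ := (abs_add_le _ _).trans (add_le_add hdiff hmeanle)
        _ = _ := by ring
    rw [abs_mul, abs_of_pos (by positivity : 0 < 2 * Real.pi), mul_comm] at h1
    exact le_of_mul_le_mul_right h1 (by positivity)
  have hsq : N ^ 2 ≤ N * (2 + 2 * C * (2 * Real.pi) ^ (1 / 2 : ℝ)) := by
    have h1 : N ^ 2 = |μ * φ z - g z| := by
      rw [hN, sq_abs, hg]; simp only [sub_sub_cancel]
      exact (abs_of_nonneg (sq_nonneg _)).symm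
    have h2 : |μ * φ z| ≤ N := by
      rw [abs_mul, abs_of_nonneg hμ.1]; exact mul_le_of_le_one_left hN0 hμ.2
    rw [h1]
    calc _ ≤ |μ * φ z| + |g z| := abs_sub _ _
      _ ≤ _ := add_le_add h2 hgz
      _ = _ := by ring
  intro x
  refine (hmax x).trans ?_
  rcases eq_or_lt_of_le hN0 with h0 | h0
  · rw [← h0]; positivity
  · rw [sq] at hsq
    exact le_of_mul_le_mul_left hsq h0

/-- Iterating the gain `β ↦ β / 2 + 1 / 4` from `β = 0` exhausts all exponents below `1 / 2`. -/
theorem exists_holderBound_of_lt_half {φ : ℝ → ℝ} {μ : ℝ} (hs : IsSolution φ μ)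
    (hle : ∀ x, φ x ≤ μ / 2) {α : ℝ} (hα : 0 ≤ α) (hα' : α < 1 / 2) :
    ∃ M, HolderBound α M φ := by
  obtain ⟨z, -, hmax⟩ := exists_abs_max hs.continuous hs.periodic
  have step : ∀ j : ℕ, ∃ M, HolderBound (1 / 2 - (1 / 2) ^ (j + 1)) M φ := by
    intro j
    induction j with
    | zero => exact ⟨_, by simpa using holderBound_zero_of_abs_le hmax⟩
    | succ j ih =>
      obtain ⟨M, hM⟩ := ih
      have h1 : (1 / 2 : ℝ) ^ (j + 1) ≤ 1 / 2 := by
        rw [pow_succ]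
        exact mul_le_of_le_one_left (by norm_num) (pow_le_one₀ (by norm_num) (by norm_num))
      have h2 : (0 : ℝ) < (1 / 2) ^ (j + 1) := by positivity
      obtain ⟨C, -, hC⟩ := exists_holderBound_solution (β := 1 / 2 - (1 / 2) ^ (j + 1))
        (by linarith) (by linarith)
      refine ⟨Real.sqrt (C * M), ?_⟩
      convert hC φ μ M hs hle hM using 1
      ring
  obtain ⟨n, hn⟩ := exists_pow_lt_of_lt_one (sub_pos.2 hα') (by norm_num : (1 / 2 : ℝ) < 1)
  obtain ⟨M, hM⟩ := step n
  refine ⟨_, hM.of_le hmax hα ?_⟩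
  have h3 : (1 / 2 : ℝ) ^ (n + 1) ≤ (1 / 2) ^ n :=
    pow_le_pow_of_le_one (by norm_num) (by norm_num) n.le_succ
  linarith

/-- Where `φ < μ / 2`, the square root is smooth and `φ` is locally as regular as `L φ`. -/
theorem exists_holderOnWith_nhds {φ : ℝ → ℝ} {μ : ℝ} (hs : IsSolution φ μ)
    (hle : ∀ x, φ x ≤ μ / 2) {x : ℝ} (hx : φ x < μ / 2) {α : ℝ≥0} (hα' : α < 1) :
    ∃ U ∈ 𝓝 x, ∃ C : ℝ≥0, HolderOnWith C α φ U := by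
  have hα1 : (α : ℝ) < 1 := by exact_mod_cast hα'
  set β : ℝ := max 0 ((α : ℝ) - 1 / 2) with hβdef
  have hβ : 0 ≤ β := le_max_left _ _
  have hβ' : β < 1 / 2 := max_lt (by norm_num) (by linarith)
  have hαβ : (α : ℝ) ≤ β + 1 / 2 := by linarith [le_max_right 0 ((α : ℝ) - 1 / 2)]
  obtain ⟨M, hM⟩ := exists_holderBound_of_lt_half hs hle hβ hβ'
  obtain ⟨C, hC, hCg⟩ := exists_holderBound_image hβ hβ'
  have hg := hCg φ _ M hs.continuous hs.periodic hs.even hM hs.equation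
  have hK := hg.nonneg
  set ε := (μ / 2 - φ x) / 2 with hε
  have hε0 : 0 < ε := by rw [hε]; linarith
  have hU : {y | φ y < μ / 2 - ε} ∩ Metric.ball x (1 / 2) ∈ 𝓝 x :=
    inter_mem ((isOpen_lt hs.continuous continuous_const).mem_nhds
      (by change φ x < μ / 2 - ε; rw [hε]; linarith)) (Metric.ball_mem_nhds x (by norm_num))
  refine ⟨_, hU, _, holderOnWith_of_abs_le (M := C * M / (2 * ε)) (by positivity) ?_⟩
  rintro y ⟨hy, hyb⟩ z ⟨hz, hzb⟩
  rcases eq_or_ne y z with rfl | hyz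
  · rw [sub_self, abs_zero]; positivity
  have hd : 0 < |y - z| := abs_pos.2 (sub_ne_zero.2 hyz)
  have hd1 : |y - z| ≤ 1 := by
    rw [Metric.mem_ball, Real.dist_eq, abs_lt] at hyb hzb
    exact abs_le.2 ⟨by linarith [hyb.1, hzb.2], by linarith [hyb.2, hzb.1]⟩
  have h1 := (hg y z).trans (mul_le_mul_of_nonneg_left
    (Real.rpow_le_rpow_of_exponent_ge hd hd1 hαβ) hK)
  rw [show (μ * φ y - φ y ^ 2) - (μ * φ z - φ z ^ 2) = (φ y - φ z) * (μ - φ y - φ z) by ring,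
    abs_mul] at h1
  have hy' : φ y < μ / 2 - ε := hy
  have hz' : φ z < μ / 2 - ε := hz
  have h2 : 2 * ε ≤ |μ - φ y - φ z| := (by linarith : 2 * ε ≤ μ - φ y - φ z).trans (le_abs_self _)
  rw [div_mul_eq_mul_div, le_div_iff₀ (by positivity)]
  exact (mul_le_mul_of_nonneg_left h2 (abs_nonneg _)).trans h1

/-! ### Compactness and passage to the limit -/

/-- Arzelà–Ascoli for periodic functions with a common Hölder bound. -/
theorem exists_subseq_tendstoUniformly {f : ℕ → ℝ → ℝ} {γ K B : ℝ} (hγ : 0 < γ)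
    (hp : ∀ n, Function.Periodic (f n) (2 * Real.pi)) (hc : ∀ n, Continuous (f n))
    (hB : ∀ n x, |f n x| ≤ B) (hK : ∀ n, HolderBound γ K (f n)) :
    ∃ (s : ℕ → ℕ) (F : ℝ → ℝ), StrictMono s ∧ TendstoUniformly (fun n => f (s n)) F atTop := by
  let I := Set.Icc (-Real.pi) Real.pi
  let b : ℕ → BoundedContinuousFunction I ℝ := fun n =>
    BoundedContinuousFunction.mkOfCompact ⟨fun x : I => f n x, (hc n).comp continuous_subtype_val⟩
  have hcomp : IsCompact (closure (Set.range b)) := by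
    refine BoundedContinuousFunction.arzela_ascoli (Metric.closedBall (0 : ℝ) B)
      (isCompact_closedBall _ _) _ ?_ ?_
    · rintro _ x ⟨n, rfl⟩
      rw [mem_closedBall_zero_iff]
      exact hB n x
    · refine Metric.equicontinuous_of_continuity_modulus (fun d => K * |d| ^ γ) ?_ _ ?_
      · have h : Continuous fun d : ℝ => K * |d| ^ γ :=
          continuous_const.mul (continuous_abs.rpow_const fun _ => Or.inr hγ.le)
        have := h.tendsto 0
        simpa [Real.zero_rpow hγ.ne'] using this
      · rintro x y ⟨_, n, rfl⟩
        have := hK n x y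
        rw [Subtype.dist_eq, Real.dist_eq, Real.dist_eq, abs_abs]
        exact this
  obtain ⟨L, -, s, hs, hL⟩ := hcomp.tendsto_subseq (x := b) fun n => subset_closure ⟨n, rfl⟩
  rw [BoundedContinuousFunction.tendsto_iff_tendstoUniformly] at hL
  have hmem : ∀ x, toIcoMod Real.two_pi_pos (-Real.pi) x ∈ I := fun x => by
    have := toIcoMod_mem_Ico Real.two_pi_pos (-Real.pi) x
    exact ⟨this.1, by linarith [this.2]⟩
  refine ⟨s, fun x => L ⟨_, hmem x⟩, hs, ?_⟩
  have h := hL.comp fun x : ℝ => (⟨_, hmem x⟩ : I)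
  intro u hu
  filter_upwards [h u hu] with n hn x
  have hx : (_, f (s n) (toIcoMod Real.two_pi_pos (-Real.pi) x)) ∈ u := hn x
  rwa [toIcoMod, (hp (s n)).sub_zsmul_eq] at hx

theorem tendsto_cosCoeff {f : ℕ → ℝ → ℝ} {F : ℝ → ℝ} {B : ℝ} (hc : ∀ n, Continuous (f n))
    (hB : ∀ n x, |f n x| ≤ B) (h : ∀ x, Tendsto (fun n => f n x) atTop (𝓝 (F x))) (k : ℕ) :
    Tendsto (fun n => cosCoeff (f n) k) atTop (𝓝 (cosCoeff F k)) := by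
  simp only [cosCoeff_eq]
  refine Tendsto.const_mul _ ?_
  refine intervalIntegral.tendsto_integral_filter_of_dominated_convergence (fun _ => B)
    (Eventually.of_forall fun n => ?_) (Eventually.of_forall fun n => ae_of_all _ fun x _ => ?_)
    intervalIntegrable_const (ae_of_all _ fun x _ => (h x).mul_const _)
  · have := hc n
    exact (by fun_prop : Continuous fun x => f n x * Real.cos (k * x)).aestronglyMeasurable
  · rw [norm_mul, Real.norm_eq_abs, Real.norm_eq_abs]
    exact (mul_le_of_le_one_right (abs_nonneg _) (Real.abs_cos_le_one _)).trans (hB n x)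

/-- A bounded pointwise limit of uniformly Hölder continuous Whitham solutions is a Whitham
solution: the cosine coefficients pass to the limit, and those of the limit are summable by
Bernstein's criterion, so its series converges and represents the limit. -/
theorem isSolution_of_tendsto {φ : ℕ → ℝ → ℝ} {μ : ℕ → ℝ} {F : ℝ → ℝ} {m γ K B : ℝ} (hγ : 0 < γ)
    (hs : ∀ n, IsSolution (φ n) (μ n)) (hμ : ∀ n, μ n ∈ Set.Icc (0 : ℝ) 1)
    (hB : ∀ n x, |φ n x| ≤ B) (hK : ∀ n, HolderBound γ K (φ n)) (hFc : Continuous F)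
    (hF : ∀ x, Tendsto (fun n => φ n x) atTop (𝓝 (F x))) (hm : Tendsto μ atTop (𝓝 m)) :
    IsSolution F m := by
  have hFp : Function.Periodic F (2 * Real.pi) := fun x =>
    tendsto_nhds_unique (hF _) (by simpa only [(hs _).periodic x] using hF x)
  have hFe : Function.Even F := fun x =>
    tendsto_nhds_unique (hF _) (by simpa only [(hs _).even x] using hF x)
  have hFK : HolderBound γ K F := fun x y =>
    le_of_tendsto ((hF x).sub (hF y)).abs (Eventually.of_forall fun n => hK n x y)
  have hB0 : 0 ≤ B := (abs_nonneg _).trans (hB 0 0)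
  have hco : ∀ k, cosCoeff (fun x => m * F x - F x ^ 2) k = cosCoeff F k * symbol k := fun k => by
    have h1 := (tendsto_cosCoeff (fun n => (hs n).continuous) hB hF k).mul_const (symbol k)
    have h2 := tendsto_cosCoeff (f := fun n x => μ n * φ n x - φ n x ^ 2) (B := B + B ^ 2)
      (fun n => by have := (hs n).continuous; fun_prop) (fun n x => by
        refine (abs_sub _ _).trans (add_le_add ?_ ?_)
        · rw [abs_mul, abs_of_nonneg (hμ n).1]
          exact (mul_le_of_le_one_left (abs_nonneg _) (hμ n).2).trans (hB n x)
        · rw [abs_pow]; exact pow_le_pow_left₀ (abs_nonneg _) (hB n x) 2)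
      (fun x => (hm.mul (hF x)).sub ((hF x).pow 2)) k
    refine tendsto_nhds_unique h2 ?_
    refine h1.congr fun n => ?_
    exact (cosCoeff_eq_of_hasSum (summable_of_isWhithamImage (hs n).equation)
      (hs n).equation k).symm
  refine ⟨hFc, hFp, hFe, fun x => ?_⟩
  have hsum : Summable (cosCoeff fun x => m * F x - F x ^ 2) := by
    rw [funext hco, ← summable_nat_add_iff 1]
    refine Summable.of_norm_bounded ((summable_nat_add_iff 1).2
      (summable_abs_cosCoeff_mul_rpow_of_holderBound hFK hγ hFc hFp hFe)) fun k => ?_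
    rw [norm_mul, Real.norm_eq_abs, Real.norm_eq_abs, abs_of_nonneg (symbol_nonneg _)]
    exact mul_le_mul_of_nonneg_left (symbol_le (Nat.succ_ne_zero k)) (abs_nonneg _)
  have := hasSum_cosCoeff (f := fun x => m * F x - F x ^ 2) (by fun_prop)
    (fun x => by simp only [hFp x]) (fun x => by simp only [hFe x]) hsum x
  simpa only [hco] using this

end Whitham

theorem theorem4p7 (α₀ : ℝ≥0) (hα₀ : 1 / 2 < α₀) (hα₀' : α₀ < 1)
    (φ : ℕ → ℝ → ℝ) (μ : ℕ → ℝ) (hS : ∀ n, (φ n, μ n) ∈ Whitham.solutionSet α₀) :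
    ∃ (s : ℕ → ℕ) (φ' : ℝ → ℝ) (μ' : ℝ),
      StrictMono s ∧
      TendstoUniformly (fun n => φ (s n)) φ' atTop ∧
      Tendsto (fun n => μ (s n)) atTop (𝓝 μ') ∧
      μ' ∈ Set.Icc (0 : ℝ) 1 ∧
      (∀ x, φ' x ≤ μ' / 2) ∧
      Whitham.IsSolution φ' μ' ∧
      (∀ α : ℝ≥0, 0 < α → α < 1 / 2 → φ' ∈ Whitham.HolderEven α) ∧
      (∀ x, φ' x < μ' / 2 → ∀ α : ℝ≥0, 0 < α → α < 1 →
        ∃ U ∈ 𝓝 x, ∃ C : ℝ≥0, HolderOnWith C α φ' U) := by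
  have hμ : ∀ n, μ n ∈ Set.Icc (0 : ℝ) 1 := fun n => Set.Ioo_subset_Icc_self (hS n).2.1
  have hsol : ∀ n, Whitham.IsSolution (φ n) (μ n) := fun n => (hS n).2.2.2
  obtain ⟨B, hB⟩ := Whitham.exists_abs_solution_le
  have hφB : ∀ n x, |φ n x| ≤ B := fun n => hB _ _ (hsol n) (hμ n)
  -- one step of the regularity gain makes the sequence uniformly `C^{1/4}`
  obtain ⟨C, -, hC⟩ := Whitham.exists_holderBound_solution le_rfl (by norm_num : (0 : ℝ) < 1 / 2)
  have hK : ∀ n, Whitham.HolderBound (0 / 2 + 1 / 4) (Real.sqrt (C * (2 * B))) (φ n) := fun n =>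
    hC _ _ _ (hsol n) (fun x => ((hS n).2.2.1 x).le)
      (Whitham.holderBound_zero_of_abs_le (hφB n))
  obtain ⟨s₁, F, hs₁, hF⟩ := Whitham.exists_subseq_tendstoUniformly (by norm_num)
    (fun n => (hsol n).periodic) (fun n => (hsol n).continuous) hφB hK
  obtain ⟨m, hm, s₂, hs₂, hμm⟩ := isCompact_Icc.tendsto_subseq (x := fun n => μ (s₁ n))
    fun n => hμ (s₁ n)
  have hU : TendstoUniformly (fun n => φ (s₁ (s₂ n))) F atTop := fun u hu =>
    hs₂.tendsto_atTop.eventually (hF u hu)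
  have hle : ∀ x, F x ≤ m / 2 := fun x =>
    le_of_tendsto_of_tendsto' (hU.tendsto_at x) (hμm.div_const 2)
      fun n => ((hS (s₁ (s₂ n))).2.2.1 x).le
  have hFsol : Whitham.IsSolution F m :=
    Whitham.isSolution_of_tendsto (by norm_num) (fun n => hsol (s₁ (s₂ n)))
      (fun n => hμ _) (fun n => hφB _) (fun n => hK _)
      (hU.continuous (Frequently.of_forall fun n => (hsol _).continuous))
      (fun x => hU.tendsto_at x) hμm
  refine ⟨fun n => s₁ (s₂ n), F, m, hs₁.comp hs₂, hU, hμm, hm, hle, hFsol, fun α _ hα => ?_,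
    fun x hx α _ hα => Whitham.exists_holderOnWith_nhds hFsol hle hx hα⟩
  have hα' : (α : ℝ) < 1 / 2 := by exact_mod_cast hα
  obtain ⟨M, hM⟩ := Whitham.exists_holderBound_of_lt_half hFsol hle α.coe_nonneg hα'
  exact ⟨hFsol.periodic, hFsol.even, _, holderOnWith_univ.1
    (Whitham.holderOnWith_of_abs_le hM.nonneg fun x _ y _ => hM x y)⟩
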